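/- Let $n,m\ge 0$, let $A=\{H_1,\dots,H_m\}$ be a configuration of affine hyperplanes $H_i=\{\alpha_i=0\}$ in $\mathbb C^n$, where each $\alpha_i\in\mathbb C[x]=\mathbb C[x_1,\dots,x_n]$ is a polynomial of degree one, and let $\beta=(\beta_1,\dots,\beta_m)\in\mathbb C^m$. Assume that $A$ is normal crossing: for every point $p\in\mathbb C^n$ and every set of distinct indices $i_1,\dots,i_k$ with $p\in H_{i_1}\cap\dots\cap H_{i_k}$ there is an affine change of coordinates of $\mathbb C^n$ to new coordinates $y_1,\dots,y_n$ centred at $p$ such that $\alpha_{i_1}=y_1,\dots,\alpha_{i_k}=y_k$. Put $\alpha=\alpha_1\cdots\alpha_m$, and let $M_\alpha^\beta$ be the free module of rank one over the localization $\mathbb C[x]_\alpha$ with generator $\alpha^\beta$, regarded as a module over the Weyl algebra $A_n=\mathbb C\langle x_1,\dots,x_n,\partial_1,\dots,\partial_n\rangle$ through the Leibniz rule and $$\partial_j(\alpha^\beta)=\sum_{i=1}^m\beta_i\,\frac{\partial_j(\alpha_i)}{\alpha_i}\,\alpha^\beta ,\qquad j=1,\dots,n .$$ Then $M_\alpha^\beta$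 is an $A_n$-module of finite length. Its decomposition factors are the quotients $M_{l+1}/M_l$ of consecutive terms of a composition series $0=M_0\subset M_1\subset\dots\subset M_r=M_\alpha^\beta$ of $A_n$-submodules, counted with multiplicity. The support of an $A_n$-module $N$ is the set of points $p\in\mathbb C^n$ such that the localization of the $\mathbb C[x]$-module $N$ at the maximal ideal of $p$ is nonzero. Let $S=\{i_1,\dots,i_k\}\subseteq\{1,\dots,m\}$ be such that the flat $H_S=H_{i_1}\cap\dots\cap H_{i_k}$ is nonempty (for $S=\emptyset$, $H_S=\mathbb C^n$). Then for every composition series of $M_\alpha^\beta$: (i) at most one decomposition factor has support equal to $H_S$; (ii) exactly one decomposition factor has support equal to $H_S$ if and only if $\beta_{i_1},\dots,\beta_{i_k}\in\mathbb Z$. -/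

import Mathlib

noncomputable section

namespace WeylArrangement

open MvPolynomial

/-! ### The Weyl algebra -/

/-- The defining relations of the `n`-th Weyl algebra, on the free algebra with generators
`x_j` (`Sum.inl j`) and `∂_j` (`Sum.inr j`). -/
inductive WeylRel (n : ℕ) :
    FreeAlgebra ℂ (Fin n ⊕ Fin n) → FreeAlgebra ℂ (Fin n ⊕ Fin n) → Prop
  | x_x (i j : Fin n) : WeylRel n
      (FreeAlgebra.ι ℂ (Sum.inl i) * FreeAlgebra.ι ℂ (Sum.inl j))
      (FreeAlgebra.ι ℂ (Sum.inl j) * FreeAlgebra.ι ℂ (Sum.inl i))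
  | d_d (i j : Fin n) : WeylRel n
      (FreeAlgebra.ι ℂ (Sum.inr i) * FreeAlgebra.ι ℂ (Sum.inr j))
      (FreeAlgebra.ι ℂ (Sum.inr j) * FreeAlgebra.ι ℂ (Sum.inr i))
  | d_x (i j : Fin n) : WeylRel n
      (FreeAlgebra.ι ℂ (Sum.inr i) * FreeAlgebra.ι ℂ (Sum.inl j))
      (FreeAlgebra.ι ℂ (Sum.inl j) * FreeAlgebra.ι ℂ (Sum.inr i) + if i = j then 1 else 0)

/-- The `n`-th Weyl algebra `A_n` over `ℂ`. -/
def WeylAlgebra (n : ℕ) : Type := RingQuot (WeylRel n)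

instance (n : ℕ) : Ring (WeylAlgebra n) := inferInstanceAs (Ring (RingQuot (WeylRel n)))

instance (n : ℕ) : Algebra ℂ (WeylAlgebra n) :=
  inferInstanceAs (Algebra ℂ (RingQuot (WeylRel n)))

/-- The quotient map from the free algebra to `A_n`. -/
def WeylAlgebra.mk (n : ℕ) : FreeAlgebra ℂ (Fin n ⊕ Fin n) →ₐ[ℂ] WeylAlgebra n :=
  RingQuot.mkAlgHom ℂ (WeylRel n)

/-- The generator `x_j` of `A_n`. -/
def WeylAlgebra.x {n : ℕ} (j : Fin n) : WeylAlgebra n :=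
  WeylAlgebra.mk n (FreeAlgebra.ι ℂ (Sum.inl j))

/-- The generator `∂_j` of `A_n`. -/
def WeylAlgebra.d {n : ℕ} (j : Fin n) : WeylAlgebra n :=
  WeylAlgebra.mk n (FreeAlgebra.ι ℂ (Sum.inr j))

lemma WeylAlgebra.x_mul_x {n : ℕ} (i j : Fin n) :
    (WeylAlgebra.x i * WeylAlgebra.x j : WeylAlgebra n)
      = WeylAlgebra.x j * WeylAlgebra.x i := by
  unfold WeylAlgebra.x
  rw [← map_mul, ← map_mul]
  exact RingQuot.mkAlgHom_rel ℂ (WeylRel.x_x i j)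

/-- The homomorphism `ℂ[x_1, …, x_n] → A_n` sending the variable `X j` to `x_j`. It is defined
through the commutative subalgebra of `A_n` generated by the `x_j`. -/
def polyToWeyl (n : ℕ) : MvPolynomial (Fin n) ℂ →ₐ[ℂ] WeylAlgebra n :=
  letI : CommRing (Algebra.adjoin ℂ (Set.range (WeylAlgebra.x (n := n)))) :=
    { (inferInstance : Ring (Algebra.adjoin ℂ (Set.range (WeylAlgebra.x (n := n))))) with
      mul_comm := (Algebra.isMulCommutative_adjoin ℂ (by
        rintro _ ⟨i, rfl⟩ _ ⟨j, rfl⟩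
        exact WeylAlgebra.x_mul_x i j)).is_comm.comm }
  (Algebra.adjoin ℂ (Set.range (WeylAlgebra.x (n := n)))).val.comp
    (aeval fun j => ⟨WeylAlgebra.x j, Algebra.subset_adjoin ⟨j, rfl⟩⟩)

lemma polyToWeyl_X {n : ℕ} (j : Fin n) : polyToWeyl n (X j) = WeylAlgebra.x j := by
  simp [polyToWeyl]

/-- The support of an `A_n`-module, as a set of points of `ℂ^n`: the points at whose maximal ideal
the underlying `ℂ[x_1, …, x_n]`-module has a nonzero localization. -/
def weylSupport {n : ℕ} (N : Type*) [AddCommGroup N] [Module (WeylAlgebra n) N] :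
    Set (Fin n → ℂ) :=
  letI : Module (MvPolynomial (Fin n) ℂ) N := Module.compHom N (polyToWeyl n).toRingHom
  {p | (pointToPoint p : PrimeSpectrum (MvPolynomial (Fin n) ℂ)) ∈
    Module.support (MvPolynomial (Fin n) ℂ) N}

/-! ### Derivations of a localization -/

section Localization

variable {P : Type*} [CommRing P] [Algebra ℂ P]

/-- The homomorphism `p ↦ (p, D p)` from `P` to the square-zero extension of `P_f` by `P_f`. -/
def toTriv (f : P) (D : Derivation ℂ P P) :
    P →ₐ[ℂ] TrivSqZeroExt (Localization.Away f) (Localization.Away f) :=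
  AlgHom.ofLinearMap
    ((TrivSqZeroExt.inlAlgHom ℂ (Localization.Away f) (Localization.Away f)).toLinearMap ∘ₗ
        (IsScalarTower.toAlgHom ℂ P (Localization.Away f)).toLinearMap +
      (TrivSqZeroExt.inrHom (Localization.Away f) (Localization.Away f)).restrictScalars ℂ ∘ₗ
        (IsScalarTower.toAlgHom ℂ P (Localization.Away f)).toLinearMap ∘ₗ (D : P →ₗ[ℂ] P))
    (by ext <;> simp)
    (fun p q => by
      ext
      · simp
      · simp only [LinearMap.add_apply, LinearMap.comp_apply, AlgHom.toLinearMap_apply,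
          IsScalarTower.coe_toAlgHom', TrivSqZeroExt.inlAlgHom_apply,
          LinearMap.restrictScalars_apply, TrivSqZeroExt.inrHom_apply, TrivSqZeroExt.snd_add,
          TrivSqZeroExt.snd_inl, TrivSqZeroExt.snd_inr, TrivSqZeroExt.snd_mul,
          TrivSqZeroExt.fst_add, TrivSqZeroExt.fst_inl, TrivSqZeroExt.fst_inr,
          Derivation.coeFn_coe, Derivation.leibniz, smul_eq_mul, MulOpposite.smul_eq_mul_unop,
          MulOpposite.unop_op, map_add, map_mul, zero_add, add_zero]
        ring)

lemma fst_toTriv (f : P) (D : Derivation ℂ P P) (p : P) :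
    (toTriv f D p).fst = algebraMap P (Localization.Away f) p := by
  simp [toTriv]

lemma snd_toTriv (f : P) (D : Derivation ℂ P P) (p : P) :
    (toTriv f D p).snd = algebraMap P (Localization.Away f) (D p) := by
  simp only [toTriv, AlgHom.ofLinearMap_apply, LinearMap.add_apply, LinearMap.comp_apply,
    AlgHom.toLinearMap_apply, IsScalarTower.coe_toAlgHom', TrivSqZeroExt.inlAlgHom_apply,
    LinearMap.restrictScalars_apply, TrivSqZeroExt.inrHom_apply, TrivSqZeroExt.snd_add,
    TrivSqZeroExt.snd_inl, TrivSqZeroExt.snd_inr, Derivation.coeFn_coe, zero_add]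

lemma isUnit_toTriv (f : P) (D : Derivation ℂ P P) (y : Submonoid.powers f) :
    IsUnit (toTriv f D y) := by
  rw [TrivSqZeroExt.isUnit_iff_isUnit_fst, fst_toTriv]
  exact IsLocalization.map_units (Localization.Away f) y

/-- The extension of `p ↦ (p, D p)` to `P_f`. -/
def locTriv (f : P) (D : Derivation ℂ P P) :
    Localization.Away f →ₐ[ℂ] TrivSqZeroExt (Localization.Away f) (Localization.Away f) :=
  IsLocalization.liftAlgHom (M := Submonoid.powers f) (f := toTriv f D) (isUnit_toTriv f D)

lemma locTriv_algebraMap (f : P) (D : Derivation ℂ P P) (p : P) :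
    locTriv f D (algebraMap P _ p) = toTriv f D p := by
  simp [locTriv]

lemma fst_locTriv (f : P) (D : Derivation ℂ P P) (a : Localization.Away f) :
    (locTriv f D a).fst = a := by
  have h : ((TrivSqZeroExt.fstHom ℂ (Localization.Away f) (Localization.Away f)).comp
      (locTriv f D)).toRingHom = RingHom.id _ := by
    refine IsLocalization.ringHom_ext (Submonoid.powers f) ?_
    ext p
    simp [locTriv_algebraMap, fst_toTriv]
  exact congrArg (fun g : _ →+* _ => g a) h

/-- The extension of a derivation `D` of `P` to the localization `P_f`, that is, the quotient
rule: it is the second component of the extension of `p ↦ (p, D p)` to `P_f`. -/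
def locDerivation (f : P) (D : Derivation ℂ P P) :
    Derivation ℂ (Localization.Away f) (Localization.Away f) :=
  Derivation.mk'
    ((TrivSqZeroExt.sndHom (Localization.Away f) (Localization.Away f)).restrictScalars ℂ ∘ₗ
      (locTriv f D).toLinearMap)
    (fun a b => by simp [fst_locTriv, mul_comm])

lemma locDerivation_algebraMap (f : P) (D : Derivation ℂ P P) (p : P) :
    locDerivation f D (algebraMap P _ p) = algebraMap P _ (D p) := by
  simp [locDerivation, locTriv_algebraMap, snd_toTriv]

/-- A derivation of `P_f` is determined by its values on `P`. -/
lemma locDerivation_ext (f : P)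
    (D₁ D₂ : Derivation ℂ (Localization.Away f) (Localization.Away f))
    (h : ∀ p : P, D₁ (algebraMap P _ p) = D₂ (algebraMap P _ p)) : D₁ = D₂ := by
  ext a
  obtain ⟨p, s, rfl⟩ := IsLocalization.exists_mk'_eq (Submonoid.powers f) a
  have key : ∀ D : Derivation ℂ (Localization.Away f) (Localization.Away f),
      algebraMap P (Localization.Away f) s * D (IsLocalization.mk' (Localization.Away f) p s)
        = D (algebraMap P _ p) - IsLocalization.mk' (Localization.Away f) p s *
          D (algebraMap P _ s) := by
    intro D
    rw [← IsLocalization.mk'_spec (Localization.Away f) p s, Derivation.leibniz]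
    simp only [smul_eq_mul]
    ring
  refine (IsLocalization.map_units (Localization.Away f) s).mul_left_cancel ?_
  rw [key, key, h, h]

end Localization

/-! ### Hyperplane arrangements and the twisted modules -/

section Arrangement

variable {n m : ℕ}

/-- The intersection `H_S = ⋂_{i ∈ S} H_i` of the zero sets `H_i = V(α_i)` in `ℂ^n`
(it is `ℂ^n` if `S` is empty). -/
def flat (α : Fin m → MvPolynomial (Fin n) ℂ) (S : Finset (Fin m)) : Set (Fin n → ℂ) :=
  {p | ∀ i ∈ S, eval p (α i) = 0}

/-- The hyperplanes `H_i = V(α_i)` form a normal crossing configuration: each `α_i` is a polynomial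
of degree one, and whenever a point `p` lies on `H_i` for all `i ∈ S`, there are affine coordinates
`φ` of `ℂ^n` centred at `p` such that the `α_i`, `i ∈ S`, are pairwise distinct coordinates. -/
structure IsNormalCrossing (α : Fin m → MvPolynomial (Fin n) ℂ) : Prop where
  totalDegree_eq_one : ∀ i, (α i).totalDegree = 1
  exists_coordinates : ∀ (p : Fin n → ℂ) (S : Finset (Fin m)), p ∈ flat α S →
    ∃ (φ : (Fin n → ℂ) ≃ᵃ[ℂ] (Fin n → ℂ)) (c : S ↪ Fin n), φ p = 0 ∧
      ∀ (i : S) (q : Fin n → ℂ), eval q (α i) = φ q (c i)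

/-- The localization `ℂ[x]_α` at the product `α = α_1 ⋯ α_m`. -/
abbrev LocRing (α : Fin m → MvPolynomial (Fin n) ℂ) : Type :=
  Localization.Away (∏ i, α i)

/-- The logarithmic derivative `∑_i β_i ∂_j(α_i) / α_i` of `α^β` in `ℂ[x]_α`. Each `α_i` is
invertible in `ℂ[x]_α`. -/
def logDeriv (α : Fin m → MvPolynomial (Fin n) ℂ) (β : Fin m → ℂ) (j : Fin n) : LocRing α :=
  ∑ i, β i • (algebraMap (MvPolynomial (Fin n) ℂ) (LocRing α) (pderiv j (α i)) *
    Ring.inverse (algebraMap (MvPolynomial (Fin n) ℂ) (LocRing α) (α i)))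

/-- The operator `r α^β ↦ (∂_j(r) + r ∑_i β_i ∂_j(α_i) / α_i) α^β` on `M_α^β`, in terms
of the coefficient `r ∈ ℂ[x]_α`. -/
def twistedD (α : Fin m → MvPolynomial (Fin n) ℂ) (β : Fin m → ℂ) (j : Fin n) :
    Module.End ℂ (LocRing α) :=
  (locDerivation (∏ i, α i) (pderiv j) : LocRing α →ₗ[ℂ] LocRing α)
    + LinearMap.mulLeft ℂ (logDeriv α β j)

/-- Multiplication by `x_j` on `ℂ[x]_α`. -/
def twistedX (α : Fin m → MvPolynomial (Fin n) ℂ) (j : Fin n) :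
    Module.End ℂ (LocRing α) :=
  LinearMap.mulLeft ℂ (algebraMap (MvPolynomial (Fin n) ℂ) (LocRing α) (X j))

lemma isUnit_algebraMap_locRing (α : Fin m → MvPolynomial (Fin n) ℂ) (i : Fin m) :
    IsUnit (algebraMap (MvPolynomial (Fin n) ℂ) (LocRing α) (α i)) :=
  isUnit_of_dvd_unit
    (map_dvd (algebraMap (MvPolynomial (Fin n) ℂ) (LocRing α))
      (Finset.dvd_prod_of_mem α (Finset.mem_univ i)))
    (IsLocalization.Away.algebraMap_isUnit (∏ i, α i))

lemma pderiv_pderiv_comm (i j : Fin n) (p : MvPolynomial (Fin n) ℂ) :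
    pderiv i (pderiv j p) = pderiv j (pderiv i p) := by
  have h : ⁅(pderiv i : Derivation ℂ (MvPolynomial (Fin n) ℂ) (MvPolynomial (Fin n) ℂ)),
      (pderiv j : Derivation ℂ (MvPolynomial (Fin n) ℂ) (MvPolynomial (Fin n) ℂ))⁆ = 0 := by
    refine MvPolynomial.derivation_ext fun k => ?_
    simp [Derivation.commutator_apply, pderiv_X, Pi.single_apply, apply_ite]
  have := DFunLike.congr_fun h p
  rw [Derivation.commutator_apply] at this
  exact sub_eq_zero.1 this

lemma locDerivation_comm (f : MvPolynomial (Fin n) ℂ) (i j : Fin n) (a : Localization.Away f) :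
    locDerivation f (pderiv i) (locDerivation f (pderiv j) a)
      = locDerivation f (pderiv j) (locDerivation f (pderiv i) a) := by
  have h : ⁅locDerivation f (pderiv i), locDerivation f (pderiv j)⁆ = 0 := by
    refine locDerivation_ext f _ _ fun p => ?_
    simp [Derivation.commutator_apply, locDerivation_algebraMap, pderiv_pderiv_comm i j]
  have := DFunLike.congr_fun h a
  rw [Derivation.commutator_apply] at this
  exact sub_eq_zero.1 this

lemma locDerivation_logDeriv (α : Fin m → MvPolynomial (Fin n) ℂ) (β : Fin m → ℂ)
    (j k : Fin n) :
    locDerivation (∏ i, α i) (pderiv k) (logDeriv α β j)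
      = locDerivation (∏ i, α i) (pderiv j) (logDeriv α β k) := by
  have key : ∀ (i : Fin m) (j k : Fin n), locDerivation (∏ i, α i) (pderiv k)
      (algebraMap (MvPolynomial (Fin n) ℂ) (LocRing α) (pderiv j (α i)) * Ring.inverse (algebraMap (MvPolynomial (Fin n) ℂ) (LocRing α) (α i)))
      = algebraMap (MvPolynomial (Fin n) ℂ) (LocRing α) (pderiv k (pderiv j (α i))) *
          Ring.inverse (algebraMap (MvPolynomial (Fin n) ℂ) (LocRing α) (α i))
        - algebraMap (MvPolynomial (Fin n) ℂ) (LocRing α) (pderiv j (α i)) * algebraMap (MvPolynomial (Fin n) ℂ) (LocRing α) (pderiv k (α i)) *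
          Ring.inverse (algebraMap (MvPolynomial (Fin n) ℂ) (LocRing α) (α i)) ^ 2 := by
    intro i j k
    set u := algebraMap (MvPolynomial (Fin n) ℂ) (LocRing α) (α i) with hu
    set v := Ring.inverse u with hv
    have huv : u * v = 1 := Ring.mul_inverse_cancel _ (isUnit_algebraMap_locRing α i)
    have h1 : v * locDerivation (∏ i, α i) (pderiv k) (u * v) = 0 := by
      rw [huv, Derivation.map_one_eq_zero, mul_zero]
    rw [Derivation.leibniz, hu, locDerivation_algebraMap, ← hu] at h1
    rw [Derivation.leibniz, locDerivation_algebraMap]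
    simp only [smul_eq_mul] at h1 ⊢
    linear_combination (algebraMap (MvPolynomial (Fin n) ℂ) (LocRing α) (pderiv j (α i))) * h1
      - (algebraMap (MvPolynomial (Fin n) ℂ) (LocRing α) (pderiv j (α i))) *
        locDerivation (∏ i, α i) (pderiv k) v * huv
  unfold logDeriv
  simp only [map_sum, Derivation.map_smul, key]
  refine Finset.sum_congr rfl fun i _ => ?_
  rw [pderiv_pderiv_comm k j]
  ring_nf

/-- The action of `A_n` on `M_α^β`, in terms of the coefficient of `α^β`. -/
def twistedAction (α : Fin m → MvPolynomial (Fin n) ℂ) (β : Fin m → ℂ) :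
    WeylAlgebra n →ₐ[ℂ] Module.End ℂ (LocRing α) :=
  RingQuot.liftAlgHom ℂ
    ⟨FreeAlgebra.lift ℂ (Sum.elim (twistedX α) (twistedD α β)), by
      intro a b h
      cases h with
      | x_x i j =>
        ext r
        simp [twistedX]
        ring
      | d_d i j =>
        ext r
        simp [twistedD, locDerivation_comm _ i j, locDerivation_logDeriv α β i j]
        ring
      | d_x i j =>
        ext r
        by_cases hij : i = j
        · subst hij
          simp [twistedD, twistedX, locDerivation_algebraMap]
          ring
        · simp [twistedD, twistedX, locDerivation_algebraMap, hij, pderiv_X_of_ne (Ne.symm hij)]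
          ring⟩

lemma twistedAction_mk (α : Fin m → MvPolynomial (Fin n) ℂ) (β : Fin m → ℂ)
    (a : FreeAlgebra ℂ (Fin n ⊕ Fin n)) :
    twistedAction α β (WeylAlgebra.mk n a)
      = FreeAlgebra.lift ℂ (Sum.elim (twistedX α) (twistedD α β)) a :=
  RingQuot.liftAlgHom_mkAlgHom_apply ℂ _ _ a

/-- The module `M_α^β`: the free `ℂ[x]_α`-module of rank one on the generator `α^β`. An element
`r α^β` is represented by its coefficient `r ∈ ℂ[x]_α`. -/
def TwistedModule (α : Fin m → MvPolynomial (Fin n) ℂ) (_β : Fin m → ℂ) : Type := LocRing α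

variable (α : Fin m → MvPolynomial (Fin n) ℂ) (β : Fin m → ℂ)

instance : AddCommGroup (TwistedModule α β) := inferInstanceAs (AddCommGroup (LocRing α))

instance : Module (LocRing α) (TwistedModule α β) :=
  inferInstanceAs (Module (LocRing α) (LocRing α))

/-- The structure of `A_n`-module on `M_α^β`. -/
instance : Module (WeylAlgebra n) (TwistedModule α β) :=
  letI : Module (Module.End ℂ (LocRing α)) (TwistedModule α β) :=
    inferInstanceAs (Module (Module.End ℂ (LocRing α)) (LocRing α))
  Module.compHom (TwistedModule α β) (twistedAction α β).toRingHom

/-- The generator `α^β` of `M_α^β`. -/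
def TwistedModule.gen : TwistedModule α β := (1 : LocRing α)

lemma TwistedModule.x_smul (j : Fin n) (r : LocRing α) :
    (WeylAlgebra.x j : WeylAlgebra n) • (r • gen α β)
      = (algebraMap (MvPolynomial (Fin n) ℂ) (LocRing α) (X j) * r) • gen α β := by
  change twistedAction α β (WeylAlgebra.x j) (r * 1) =
    (algebraMap (MvPolynomial (Fin n) ℂ) (LocRing α) (X j) * r * 1 : LocRing α)
  simp [twistedAction_mk, WeylAlgebra.x, twistedX]

lemma TwistedModule.d_smul (j : Fin n) (r : LocRing α) :
    (WeylAlgebra.d j : WeylAlgebra n) • (r • gen α β)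
      = (locDerivation (∏ i, α i) (pderiv j) r + r * logDeriv α β j) • gen α β := by
  change twistedAction α β (WeylAlgebra.d j) (r * 1) =
    ((locDerivation (∏ i, α i) (pderiv j) r + r * logDeriv α β j) * 1 : LocRing α)
  simp [twistedAction_mk, WeylAlgebra.d, twistedD, mul_comm]

end Arrangement

/-! ### Decomposition factors -/

/-- The number of factors `s_{i+1} / s_i` of a composition series `s` of `A_n`-submodules
whose support is `Z`. -/
def numFactorsWithSupport {n : ℕ} {M : Type*} [AddCommGroup M] [Module (WeylAlgebra n) M]
    (s : CompositionSeries (Submodule (WeylAlgebra n) M)) (Z : Set (Fin n → ℂ)) : ℕ :=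
  Nat.card {i : Fin s.length //
    weylSupport (s i.succ ⧸ (s i.castSucc).submoduleOf (s i.succ)) = Z}

end WeylArrangement

end

noncomputable section

namespace WeylArrangement

open MvPolynomial

/-! ### Submodules over the Weyl algebra -/

section WeylModule

variable {n : ℕ}

/-! Take integers c_i with β_i = c_i whenever β_i is an integer; call such an index resonant. Write
elements as f ∏ α_i^(a_i - c_i) α^β, so that for resonant i the number a_i is the actual exponent of
α_i. A derivative lowers a_i by one with coefficient proportional to a_i - c_i + β_i, which is a_i
for resonant i. Hence no pole along a resonant hyperplane is created from a_i = 0, and the elements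
whose resonant poles all lie along the H_i, i ∈ S, form a submodule `poleSub S`.

List the sets S of resonant indices with nonempty flat in an order refining inclusion and add the
`poleSub S` one by one. Nothing is lost by omitting empty flats: there `poleSub S` is a sum of
smaller ones, by the Nullstellensatz. Each step adds one simple factor with support the flat of S.
It is nonzero because earlier terms each lack a pole along some H_i, i ∈ S, and so contribute
nothing to the residue along the flat (`eval_eq_zero_of_mono_mem`).

It is simple because any nonzero class generates it. Derivatives transverse to the flat reduce the
poles along S to simple ones (`exists_simple_pole`); tangential derivatives reduce the residue to a
power of the product of the nonresonant α_i (`exists_nonresProd_pow_mem`); then the poles along S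
and the nonresonant hyperplanes can be raised at will (`mono_sub_single_mem`).

By normal crossing, distinct S have distinct flats, so a flat occurs once if S is resonant and never
otherwise. Jordan–Hölder carries this count to every composition series. -/

lemma polyToWeyl_C (z : ℂ) : polyToWeyl n (C z) = algebraMap ℂ (WeylAlgebra n) z :=
  (polyToWeyl n).commutes z

/-- An additive subgroup of an `A_n`-module stable under polynomials and the `∂_j` is stable
under `A_n`. -/
lemma smul_mem_of_poly_of_d {M : Type*} [AddCommGroup M] [Module (WeylAlgebra n) M]
    (N : AddSubgroup M)
    (hpoly : ∀ (f : MvPolynomial (Fin n) ℂ), ∀ r ∈ N, polyToWeyl n f • r ∈ N)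
    (hd : ∀ (j : Fin n), ∀ r ∈ N, (WeylAlgebra.d j : WeylAlgebra n) • r ∈ N)
    (w : WeylAlgebra n) (r : M) (hr : r ∈ N) : w • r ∈ N := by
  obtain ⟨w, rfl⟩ := RingQuot.mkAlgHom_surjective ℂ (WeylRel n) w
  change WeylAlgebra.mk n w • r ∈ N
  induction w using FreeAlgebra.induction generalizing r with
  | grade0 z =>
    have := hpoly (C z) r hr
    rw [polyToWeyl_C] at this
    rwa [AlgHom.commutes]
  | grade1 j =>
    rcases j with j | j
    · have := hpoly (X j) r hr
      rwa [polyToWeyl_X] at this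
    · exact hd j r hr
  | mul a b ha hb =>
    rw [map_mul, mul_smul]
    exact ha _ (hb _ hr)
  | add a b ha hb =>
    rw [map_add, add_smul]
    exact N.add_mem (ha _ hr) (hb _ hr)

/-- The constant vector field `∑_j v_j ∂_j`, as an element of `A_n`. -/
def weylD (v : Fin n → ℂ) : WeylAlgebra n := ∑ j, polyToWeyl n (C (v j)) * WeylAlgebra.d j

/-- The constant vector field `∑_j v_j ∂_j`, as a derivation of the polynomial ring. -/
def polyD (v : Fin n → ℂ) : Derivation ℂ (MvPolynomial (Fin n) ℂ) (MvPolynomial (Fin n) ℂ) :=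
  ∑ j, v j • pderiv j

lemma polyD_apply (v : Fin n → ℂ) (f : MvPolynomial (Fin n) ℂ) :
    polyD v f = ∑ j, C (v j) * pderiv j f := by
  rw [polyD, ← Derivation.coeFnAddMonoidHom_apply, map_sum, Finset.sum_apply]
  simp [smul_eq_C_mul]

lemma polyD_single (j : Fin n) (f : MvPolynomial (Fin n) ℂ) :
    polyD (Pi.single j 1) f = pderiv j f := by
  classical
  rw [polyD_apply, Finset.sum_eq_single j]
  · simp
  · intro k _ hk
    simp [Pi.single_eq_of_ne hk]
  · simp

end WeylModule

/-! ### Monomial elements of the twisted module -/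

section Mono

variable {n m : ℕ} (α : Fin m → MvPolynomial (Fin n) ℂ) (β : Fin m → ℂ)

lemma poly_smul_gen (h : MvPolynomial (Fin n) ℂ) (r : LocRing α) :
    polyToWeyl n h • (r • TwistedModule.gen α β)
      = (algebraMap _ (LocRing α) h * r) • TwistedModule.gen α β := by
  induction h using MvPolynomial.induction_on generalizing r with
  | C z =>
    rw [polyToWeyl_C]
    change twistedAction α β (algebraMap ℂ _ z) (r * 1 : LocRing α) =
      (algebraMap (MvPolynomial (Fin n) ℂ) (LocRing α) (C z) * r * 1 : LocRing α)
    rw [AlgHom.commutes, mul_one, mul_one, Module.algebraMap_end_apply, ← algebraMap_eq,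
      ← IsScalarTower.algebraMap_apply, Algebra.smul_def]
  | add p q hp hq => rw [map_add, add_smul, hp, hq, ← add_smul, map_add, add_mul]
  | mul_X p j hp =>
    rw [map_mul, mul_smul, polyToWeyl_X, TwistedModule.x_smul, hp, map_mul, mul_assoc]

/-- `α_i` as a unit of the localization. -/
def unitOf (i : Fin m) : (LocRing α)ˣ := (isUnit_algebraMap_locRing α i).unit

lemma val_unitOf (i : Fin m) :
    (unitOf α i : LocRing α) = algebraMap (MvPolynomial (Fin n) ℂ) (LocRing α) (α i) := rfl

/-- The unit `∏ α_i ^ a_i` of the localization. -/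
def unitMono (a : Fin m → ℤ) : (LocRing α)ˣ := ∏ i, unitOf α i ^ a i

lemma unitMono_add (a b : Fin m → ℤ) : unitMono α (a + b) = unitMono α a * unitMono α b := by
  simp [unitMono, zpow_add, Finset.prod_mul_distrib]

lemma prod_zpow_single {G : Type*} [CommGroup G] (u : Fin m → G) (i : Fin m) (k : ℤ) :
    ∏ j, u j ^ (Pi.single i k : Fin m → ℤ) j = u i ^ k := by
  rw [Finset.prod_eq_single i]
  · simp
  · intro j _ hj
    simp [Pi.single_eq_of_ne hj]
  · simp

lemma unitMono_single (i : Fin m) (k : ℤ) :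
    unitMono α (Pi.single i k) = unitOf α i ^ k := prod_zpow_single _ i k

/-- The logarithmic derivative of units. -/
def logDer {R : Type*} [CommRing R] [Algebra ℂ R] (D : Derivation ℂ R R) :
    Rˣ →* Multiplicative R where
  toFun u := Multiplicative.ofAdd ((↑u⁻¹ : R) * D u)
  map_one' := by simp
  map_mul' u v := by
    rw [← ofAdd_add]
    congr 1
    have h1 : (↑u⁻¹ : R) * u = 1 := u.inv_mul
    have h2 : (↑v⁻¹ : R) * v = 1 := v.inv_mul
    simp only [mul_inv, Units.val_mul, Derivation.leibniz, smul_eq_mul]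
    linear_combination (↑v⁻¹ * D v) * h1 + (↑u⁻¹ * D u) * h2

lemma derivation_unit {R : Type*} [CommRing R] [Algebra ℂ R] (D : Derivation ℂ R R) (u : Rˣ) :
    D u = u * Multiplicative.toAdd (logDer D u) := by
  simp [logDer]

variable {α}

/-- The map u ↦ u⁻¹ D u is a homomorphism from units to the additive group, which treats positive
and negative exponents alike. -/
lemma locDerivation_unitMono (a : Fin m → ℤ) (j : Fin n) :
    locDerivation (∏ i, α i) (pderiv j) (unitMono α a : LocRing α)
      = (unitMono α a : LocRing α) * ∑ i, (a i : ℂ) •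
        (algebraMap _ (LocRing α) (pderiv j (α i)) * (↑(unitOf α i)⁻¹ : LocRing α)) := by
  rw [derivation_unit]
  congr 1
  rw [unitMono, map_prod, toAdd_prod]
  refine Finset.sum_congr rfl fun i _ => ?_
  rw [map_zpow, toAdd_zpow, logDer]
  simp only [MonoidHom.coe_mk, OneHom.coe_mk, toAdd_ofAdd, val_unitOf, locDerivation_algebraMap]
  rw [mul_comm, Int.cast_smul_eq_zsmul]

lemma logDeriv_eq (j : Fin n) : logDeriv α β j = ∑ i, β i •
    (algebraMap _ (LocRing α) (pderiv j (α i)) * (↑(unitOf α i)⁻¹ : LocRing α)) := by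
  unfold logDeriv
  simp_rw [← val_unitOf, Ring.inverse_unit]

variable (α) (c : Fin m → ℤ)

/-- The element `f ∏ α_i ^ (a_i - c_i) α^β` of the twisted module. -/
def mono (a : Fin m → ℤ) (f : MvPolynomial (Fin n) ℂ) : TwistedModule α β :=
  (algebraMap _ (LocRing α) f * (unitMono α (a - c) : LocRing α)) • TwistedModule.gen α β

variable {α β c}

lemma mono_add (a : Fin m → ℤ) (f g : MvPolynomial (Fin n) ℂ) :
    mono α β c a (f + g) = mono α β c a f + mono α β c a g := by
  simp [mono, add_mul, add_smul]

lemma poly_smul_mono (h : MvPolynomial (Fin n) ℂ) (a : Fin m → ℤ) (f : MvPolynomial (Fin n) ℂ) :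
    polyToWeyl n h • mono α β c a f = mono α β c a (h * f) := by
  rw [mono, poly_smul_gen, mono, map_mul, mul_assoc]

lemma mono_zero (a : Fin m → ℤ) : mono α β c a 0 = 0 := by simp [mono]

lemma mono_sum {ι : Type*} (s : Finset ι) (a : Fin m → ℤ) (f : ι → MvPolynomial (Fin n) ℂ) :
    mono α β c a (∑ i ∈ s, f i) = ∑ i ∈ s, mono α β c a (f i) := by
  simp [mono, Finset.sum_mul, Finset.sum_smul]

lemma mono_neg (a : Fin m → ℤ) (f : MvPolynomial (Fin n) ℂ) :
    mono α β c a (-f) = -mono α β c a f := by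
  simp [mono, neg_mul, neg_smul]

lemma mono_mul_pow (a : Fin m → ℤ) (i : Fin m) (k : ℕ) (f : MvPolynomial (Fin n) ℂ) :
    mono α β c a (α i ^ k * f) = mono α β c (a + Pi.single i (k : ℤ)) f := by
  have : a + Pi.single i (k : ℤ) - c = Pi.single i (k : ℤ) + (a - c) := by abel
  rw [mono, mono, this, unitMono_add, unitMono_single, map_mul, map_pow, ← val_unitOf]
  simp only [Units.val_mul, zpow_natCast, Units.val_pow_eq_pow_val]
  ring_nf

lemma mono_mul (a : Fin m → ℤ) (i : Fin m) (f : MvPolynomial (Fin n) ℂ) :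
    mono α β c a (α i * f) = mono α β c (a + Pi.single i 1) f := by
  simpa using mono_mul_pow (β := β) (c := c) a i 1 f

/-- The total exponent of α_i is a_i - c_i + β_i. If β_i = c_i and a_i = 0, the i-th term vanishes:
this is what makes `poleSub` stable. -/
lemma d_smul_mono (j : Fin n) (a : Fin m → ℤ) (f : MvPolynomial (Fin n) ℂ) :
    (WeylAlgebra.d j : WeylAlgebra n) • mono α β c a f = mono α β c a (pderiv j f)
      + ∑ i, mono α β c (a - Pi.single i 1)
        (C ((a i : ℂ) - c i + β i) * pderiv j (α i) * f) := by
  simp only [mono]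
  rw [TwistedModule.d_smul, ← Finset.sum_smul, ← add_smul, Derivation.leibniz,
    locDerivation_algebraMap, locDerivation_unitMono, logDeriv_eq]
  have h : ∀ i, (unitMono α (a - Pi.single i 1 - c) : LocRing α)
      = (unitMono α (a - c) : LocRing α) * (↑(unitOf α i)⁻¹ : LocRing α) := by
    intro i
    have : a - Pi.single i 1 - c = (a - c) + Pi.single i (-1) := by
      rw [Pi.single_neg]; abel
    rw [this, unitMono_add, unitMono_single, Units.val_mul, zpow_neg_one]
  have hC : ∀ z : ℂ, (algebraMap (MvPolynomial (Fin n) ℂ) (LocRing α)) (C z)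
      = algebraMap ℂ (LocRing α) z := fun z => by
    rw [← algebraMap_eq, ← IsScalarTower.algebraMap_apply]
  simp only [h, smul_eq_mul, map_mul, hC, Algebra.smul_def]
  have key : (algebraMap (MvPolynomial (Fin n) ℂ) (LocRing α) f) *
      (unitMono α (a - c) : LocRing α) * ∑ i, (algebraMap ℂ (LocRing α) ((a i : ℂ) - c i + β i) *
        (algebraMap _ (LocRing α) (pderiv j (α i)) * (↑(unitOf α i)⁻¹ : LocRing α)))
      = ∑ i, algebraMap ℂ (LocRing α) ((a i : ℂ) - c i + β i) *
        algebraMap _ (LocRing α) (pderiv j (α i)) * algebraMap _ (LocRing α) f *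
        ((unitMono α (a - c) : LocRing α) * (↑(unitOf α i)⁻¹ : LocRing α)) := by
    rw [Finset.mul_sum]
    exact Finset.sum_congr rfl fun i _ => by ring
  rw [← key]
  simp only [map_add, map_sub, map_intCast, add_mul, Pi.sub_apply, Int.cast_sub, Finset.sum_add_distrib]
  congr 1
  ring

lemma weylD_smul_mono (v : Fin n → ℂ) (a : Fin m → ℤ) (f : MvPolynomial (Fin n) ℂ) :
    weylD v • mono α β c a f = mono α β c a (polyD v f)
      + ∑ i, mono α β c (a - Pi.single i 1)
        (C ((a i : ℂ) - c i + β i) * polyD v (α i) * f) := by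
  rw [weylD, Finset.sum_smul, polyD_apply, mono_sum]
  simp_rw [mul_smul, d_smul_mono, smul_add, Finset.smul_sum, poly_smul_mono]
  rw [Finset.sum_add_distrib, Finset.sum_comm]
  congr 1
  refine Finset.sum_congr rfl fun i _ => ?_
  rw [polyD_apply, ← mono_sum, Finset.mul_sum, Finset.sum_mul]
  congr 1
  exact Finset.sum_congr rfl fun j _ => by ring

/-- Brings finitely many elements to common exponents, where they can be added and compared by
numerators. -/
lemma mono_of_le {a b : Fin m → ℤ} (h : b ≤ a) (f : MvPolynomial (Fin n) ℂ) :
    mono α β c a f = mono α β c b ((∏ i, α i ^ (a i - b i).toNat) * f) := by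
  have h1 : a - c = (a - b) + (b - c) := by abel
  have h2 : algebraMap _ (LocRing α) (∏ i, α i ^ (a i - b i).toNat)
      = (unitMono α (a - b) : LocRing α) := by
    rw [unitMono, map_prod, Units.coe_prod]
    refine Finset.prod_congr rfl fun i _ => ?_
    rw [map_pow, ← val_unitOf, ← Units.val_pow_eq_pow_val, ← zpow_natCast,
      Int.toNat_of_nonneg (sub_nonneg.2 (h i)), Pi.sub_apply]
  rw [mono, mono, h1, unitMono_add, map_mul, h2, Units.val_mul]
  ring_nf

lemma exists_mono_eq (r : TwistedModule α β) : ∃ (a : Fin m → ℤ) (f : MvPolynomial (Fin n) ℂ),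
    r = mono α β c a f := by
  obtain ⟨f, ⟨_, k, rfl⟩, h⟩ :=
    IsLocalization.exists_mk'_eq (Submonoid.powers (∏ i, α i)) (show LocRing α from r)
  -- Since `mono` uses the exponents a - c, this choice gives the denominator α^k.
  refine ⟨c - fun _ => (k : ℤ), f, ?_⟩
  rw [mono, sub_sub_cancel_left]
  change (show LocRing α from r) = (_ * 1 : LocRing α)
  rw [mul_one, ← h]
  refine (IsLocalization.mk'_eq_iff_eq_mul (S := LocRing α)).2 ?_
  rw [mul_assoc]
  conv_lhs => rw [← mul_one (algebraMap _ _ f)]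
  congr 1
  have : (unitMono α (-fun _ => (k : ℤ)) : LocRing α)
      = (((∏ i, unitOf α i ^ k)⁻¹ : (LocRing α)ˣ) : LocRing α) := by
    simp [unitMono]
  rw [this, eq_comm, Units.inv_mul_eq_one, Units.coe_prod]
  simp [val_unitOf, Finset.prod_pow]

lemma mono_injective (hα : ∀ i, α i ≠ 0) (a : Fin m → ℤ) :
    Function.Injective (mono α β c a) := by
  intro f g h
  have h' : algebraMap _ (LocRing α) f * (unitMono α (a - c) : LocRing α) * 1
    = algebraMap _ (LocRing α) g * (unitMono α (a - c) : LocRing α) * 1 := h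
  rw [mul_one, mul_one, Units.mul_left_inj] at h'
  refine IsLocalization.injective (LocRing α) (M := Submonoid.powers (∏ i, α i)) ?_ h'
  exact powers_le_nonZeroDivisors_of_noZeroDivisors (Finset.prod_ne_zero_iff.2 fun i _ => hα i)

end Mono

/-! ### Geometry of a normal crossing configuration -/

section Geometry

variable {n m : ℕ} {α : Fin m → MvPolynomial (Fin n) ℂ}

lemma polyD_X (v : Fin n → ℂ) (j : Fin n) : polyD v (X j) = C (v j) := by
  classical
  rw [polyD_apply, Finset.sum_eq_single j]
  · simp
  · intro k _ hk
    simp [pderiv_X_of_ne hk.symm]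
  · simp

/-- A polynomial of degree at most one is affine-linear. -/
lemma eq_affine_of_totalDegree_le_one {f : MvPolynomial (Fin n) ℂ} (hf : f.totalDegree ≤ 1) :
    f = C (coeff 0 f) + ∑ j, C (coeff (Finsupp.single j 1) f) * X j := by
  classical
  ext d
  simp only [coeff_add, coeff_C, coeff_sum, coeff_C_mul, coeff_X]
  rcases Nat.lt_or_ge 1 (d.degree) with h | h
  · rw [coeff_eq_zero_of_totalDegree_lt (lt_of_le_of_lt hf (by simpa [Finsupp.degree_apply] using h))]
    have h0 : (0 : Fin n →₀ ℕ) ≠ d := by rintro rfl; simp at h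
    have h1 : ∀ j : Fin n, Finsupp.single j 1 ≠ d := by rintro j rfl; simp at h
    simp [h0, h1]
  · rcases Nat.eq_zero_or_pos d.degree with h' | h'
    · rw [Finsupp.degree_eq_zero_iff] at h'
      subst h'
      simp
    · obtain ⟨j, rfl⟩ : ∃ j, d = Finsupp.single j 1 :=
        (Set.ext_iff.1 Finsupp.range_single_one d).2 (le_antisymm h h') |>.imp fun _ => Eq.symm
      have h0 : (0 : Fin n →₀ ℕ) ≠ Finsupp.single j 1 := by
        intro h; simpa using congrArg Finsupp.degree h
      simp [h0, Finsupp.single_left_inj]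

variable (α) in
/-- The linear part of `α_i`. -/
def lin (i : Fin m) (v : Fin n → ℂ) : ℂ := ∑ j, coeff (Finsupp.single j 1) (α i) * v j

lemma IsNormalCrossing.eval_add (hα : IsNormalCrossing α) (i : Fin m) (q v : Fin n → ℂ) :
    eval (q + v) (α i) = eval q (α i) + lin α i v := by
  have h := eq_affine_of_totalDegree_le_one (hα.totalDegree_eq_one i).le
  have h1 : ∀ w : Fin n → ℂ, eval w (α i)
      = coeff 0 (α i) + ∑ j, coeff (Finsupp.single j 1) (α i) * w j := fun w => by
    conv_lhs => rw [h]
    simp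
  rw [h1, h1, lin]
  simp [mul_add, Finset.sum_add_distrib, add_assoc]

lemma IsNormalCrossing.polyD_eq (hα : IsNormalCrossing α) (i : Fin m) (v : Fin n → ℂ) :
    polyD v (α i) = C (lin α i v) := by
  have h := eq_affine_of_totalDegree_le_one (hα.totalDegree_eq_one i).le
  have h1 : ∀ z, polyD v (C z) = 0 := fun z => (polyD v).map_algebraMap z
  conv_lhs => rw [h]
  rw [lin]
  simp [h1, polyD_X, mul_comm]

lemma IsNormalCrossing.ne_zero (hα : IsNormalCrossing α) (i : Fin m) : α i ≠ 0 := by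
  intro h
  simpa [h] using hα.totalDegree_eq_one i

/-- The vectors `v_i` are dual to the linear parts of the `α_k`, `i, k ∈ S`. -/
def IsDual (α : Fin m → MvPolynomial (Fin n) ℂ) (S : Finset (Fin m))
    (v : Fin m → Fin n → ℂ) : Prop :=
  ∀ i ∈ S, ∀ k ∈ S, lin α k (v i) = if k = i then 1 else 0

/-- In adapted coordinates the α_i, i ∈ S, are distinct coordinate functions, so the corresponding
coordinate vectors, pulled back by the linear part of φ, are dual to them. -/
lemma IsNormalCrossing.exists_dual (hα : IsNormalCrossing α) {p : Fin n → ℂ}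
    {S : Finset (Fin m)} (hp : p ∈ flat α S) : ∃ v, IsDual α S v := by
  classical
  obtain ⟨φ, c, hφ, h⟩ := hα.exists_coordinates p S hp
  refine ⟨fun i => if hi : i ∈ S then φ.linear.symm (Pi.single (c ⟨i, hi⟩) 1) else 0, ?_⟩
  intro i hi k hk
  simp only [hi, dif_pos]
  set w := φ.linear.symm (Pi.single (c ⟨i, hi⟩) 1) with hw
  have h1 := hα.eval_add k p w
  rw [hp k hk, zero_add, h ⟨k, hk⟩, add_comm p w] at h1
  have h2 : φ (w + p) = φ.linear w + φ p := φ.map_vadd p w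
  rw [← h1, h2, hφ, add_zero, hw, LinearEquiv.apply_symm_apply, Pi.single_apply]
  simp

lemma mem_flat_insert [DecidableEq (Fin m)] {S : Finset (Fin m)} {j : Fin m} {p : Fin n → ℂ}
    (hp : p ∈ flat α S) (hj : eval p (α j) = 0) : p ∈ flat α (insert j S) := by
  intro i hi
  rcases Finset.mem_insert.1 hi with rfl | hi
  · exact hj
  · exact hp i hi

lemma flat_anti {S S' : Finset (Fin m)} (h : S ⊆ S') : flat α S' ⊆ flat α S :=
  fun _ hp i hi => hp i (h hi)

/-- A flat is not contained in any of the other hyperplanes. -/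
lemma IsNormalCrossing.exists_mem_flat_ne (hα : IsNormalCrossing α) {S : Finset (Fin m)}
    (hS : (flat α S).Nonempty) {j : Fin m} (hj : j ∉ S) :
    ∃ q ∈ flat α S, eval q (α j) ≠ 0 := by
  classical
  obtain ⟨p, hp⟩ := hS
  by_cases h : eval p (α j) = 0
  -- If p also lies on H_j, moving along the dual vector v_j leaves H_j without leaving the flat of
  -- S.
  · obtain ⟨v, hv⟩ := hα.exists_dual (mem_flat_insert hp h)
    refine ⟨p + v j, fun i hi => ?_, ?_⟩
    · rw [hα.eval_add, hp i hi, hv j (by simp) i (by simp [hi]), if_neg, add_zero]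
      rintro rfl
      exact hj hi
    · rw [hα.eval_add, h, hv j (by simp) j (by simp)]
      simp
  · exact ⟨p, hp, h⟩

lemma IsNormalCrossing.flat_injOn (hα : IsNormalCrossing α) {S S' : Finset (Fin m)}
    (hS : (flat α S).Nonempty) (h : flat α S = flat α S') : S = S' := by
  refine Finset.Subset.antisymm (fun i hi => ?_) (fun i hi => ?_)
  · by_contra hi'
    obtain ⟨q, hq, hne⟩ := hα.exists_mem_flat_ne (h ▸ hS) hi'
    exact hne ((h ▸ hq : q ∈ flat α S) i hi)
  · by_contra hi'
    obtain ⟨q, hq, hne⟩ := hα.exists_mem_flat_ne hS hi'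
    exact hne ((h ▸ hq : q ∈ flat α S') i hi)

/-! ### Projection onto a flat, generic points and residues -/

variable (α) in
/-- Restriction of a polynomial to the flat of `S` along the projection in the directions `v_i`. -/
def retract (S : Finset (Fin m)) (v : Fin m → Fin n → ℂ) :
    MvPolynomial (Fin n) ℂ →ₐ[ℂ] MvPolynomial (Fin n) ℂ :=
  aeval fun j => X j - ∑ i ∈ S, α i * C (v i j)

variable (α) in
/-- The projection onto the flat of `S` in the directions `v_i`. -/
def proj (S : Finset (Fin m)) (v : Fin m → Fin n → ℂ) (q : Fin n → ℂ) : Fin n → ℂ :=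
  q + -∑ i ∈ S, eval q (α i) • v i

variable {S : Finset (Fin m)} {v : Fin m → Fin n → ℂ}

lemma eval_retract (q : Fin n → ℂ) (f : MvPolynomial (Fin n) ℂ) :
    eval q (retract α S v f) = eval (proj α S v q) f := by
  induction f using MvPolynomial.induction_on with
  | C z => simp [retract]
  | add f g hf hg => simp [hf, hg]
  | mul_X f j hf =>
    rw [map_mul, map_mul, hf, map_mul]
    simp [retract, proj, sub_eq_add_neg]

lemma lin_add (i : Fin m) (v w : Fin n → ℂ) : lin α i (v + w) = lin α i v + lin α i w := by
  simp [lin, mul_add, Finset.sum_add_distrib]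

lemma lin_smul (i : Fin m) (z : ℂ) (v : Fin n → ℂ) : lin α i (z • v) = z * lin α i v := by
  simp only [lin, Pi.smul_apply, smul_eq_mul, Finset.mul_sum]
  exact Finset.sum_congr rfl fun _ _ => by ring

lemma lin_neg (i : Fin m) (v : Fin n → ℂ) : lin α i (-v) = -lin α i v := by
  simp [lin]

lemma lin_zero (i : Fin m) : lin α i 0 = 0 := by simp [lin]

lemma lin_sum {ι : Type*} (i : Fin m) (s : Finset ι) (w : ι → Fin n → ℂ) :
    lin α i (∑ k ∈ s, w k) = ∑ k ∈ s, lin α i (w k) := by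
  classical
  induction s using Finset.induction_on with
  | empty => simp [lin_zero]
  | insert k s hk ih => rw [Finset.sum_insert hk, Finset.sum_insert hk, lin_add, ih]

lemma IsDual.lin_sum_smul (hv : IsDual α S v) {k : Fin m} (hk : k ∈ S) (t : Fin m → ℂ) :
    lin α k (∑ i ∈ S, t i • v i) = t k := by
  rw [lin_sum, Finset.sum_eq_single k]
  · rw [lin_smul, hv k hk k hk]; simp
  · intro i hi hik
    rw [lin_smul, hv i hi k hk, if_neg hik.symm, mul_zero]
  · exact fun h => absurd hk h

lemma IsNormalCrossing.proj_mem (hα : IsNormalCrossing α) (hv : IsDual α S v) (q : Fin n → ℂ) :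
    proj α S v q ∈ flat α S := by
  intro k hk
  rw [proj, hα.eval_add, lin_neg, hv.lin_sum_smul hk]
  ring

lemma proj_eq_self {q : Fin n → ℂ} (hq : q ∈ flat α S) : proj α S v q = q := by
  rw [proj, Finset.sum_eq_zero, neg_zero, add_zero]
  intro i hi
  rw [hq i hi, zero_smul]

/-- The projection has image in the flat and fixes it pointwise, so functions on the flat become
polynomials on all of ℂ^n. -/
lemma IsNormalCrossing.retract_eq_zero_iff (hα : IsNormalCrossing α) (hv : IsDual α S v)
    {f : MvPolynomial (Fin n) ℂ} : retract α S v f = 0 ↔ ∀ q ∈ flat α S, eval q f = 0 := by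
  refine ⟨fun h q hq => ?_, fun h => MvPolynomial.funext fun q => ?_⟩
  · rw [← proj_eq_self (v := v) hq, ← eval_retract, h, map_zero]
  · rw [eval_retract, h _ (hα.proj_mem hv q), map_zero]

lemma sub_retract_mem (f : MvPolynomial (Fin n) ℂ) :
    f - retract α S v f ∈ Ideal.span (α '' S) := by
  rw [← Ideal.Quotient.mk_eq_mk_iff_sub_mem]
  induction f using MvPolynomial.induction_on with
  | C z => simp [retract]
  | add f g hf hg => simp [hf, hg]
  | mul_X f j hf =>
    rw [map_mul, map_mul, hf, map_mul]
    congr 1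
    rw [Ideal.Quotient.mk_eq_mk_iff_sub_mem]
    simp only [retract, aeval_X, sub_sub_cancel]
    exact Ideal.sum_mem _ fun i hi =>
      Ideal.mul_mem_right _ _ (Ideal.subset_span ⟨i, hi, rfl⟩)

/-- The projection is constant in the directions v_i. -/
lemma IsNormalCrossing.polyD_retract (hα : IsNormalCrossing α) (hv : IsDual α S v) {i : Fin m}
    (hi : i ∈ S) (f : MvPolynomial (Fin n) ℂ) : polyD (v i) (retract α S v f) = 0 := by
  have hC : ∀ w z, polyD (n := n) w (C z) = 0 := fun w z => (polyD w).map_algebraMap z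
  induction f using MvPolynomial.induction_on with
  | C z => simp [retract, hC]
  | add f g hf hg => simp [hf, hg]
  | mul_X f j hf =>
    rw [map_mul, Derivation.leibniz, hf, smul_zero, add_zero]
    have : polyD (v i) (retract α S v (X j)) = 0 := by
      simp only [retract, aeval_X, map_sub, polyD_X, map_sum, Derivation.leibniz, hC,
        hα.polyD_eq, smul_eq_mul]
      rw [Finset.sum_eq_single i]
      · rw [hv i hi i hi]; simp
      · intro k hk hki
        rw [hv i hi k hk, if_neg hki]; simp
      · exact fun h => absurd hi h
    rw [this, smul_zero]

/-- A flat contains a point which is on none of the other hyperplanes and at which a given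
polynomial, not vanishing on the flat, is not zero. -/
lemma IsNormalCrossing.exists_generic (hα : IsNormalCrossing α)
    {f : MvPolynomial (Fin n) ℂ} (hf : ∃ q ∈ flat α S, eval q f ≠ 0) :
    ∃ q ∈ flat α S, eval q f ≠ 0 ∧ ∀ j ∉ S, eval q (α j) ≠ 0 := by
  classical
  obtain ⟨p, hp, hpf⟩ := hf
  obtain ⟨v, hv⟩ := hα.exists_dual hp
  -- The polynomial ring is a domain, so the product of the nonzero restrictions to the flat is
  -- nonzero; a point where it does not vanish projects to the required one.
  have h1 : retract α S v f * ∏ j ∈ Sᶜ, retract α S v (α j) ≠ 0 := by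
    refine mul_ne_zero (fun h => hpf ((hα.retract_eq_zero_iff hv).1 h p hp))
      (Finset.prod_ne_zero_iff.2 fun j hj h => ?_)
    obtain ⟨q, hq, hne⟩ := hα.exists_mem_flat_ne ⟨p, hp⟩ (Finset.mem_compl.1 hj)
    exact hne ((hα.retract_eq_zero_iff hv).1 h q hq)
  obtain ⟨q, hq⟩ : ∃ q, eval q (retract α S v f * ∏ j ∈ Sᶜ, retract α S v (α j)) ≠ 0 := by
    by_contra! h
    exact h1 (MvPolynomial.funext fun q => by rw [h q, map_zero])
  rw [map_mul, map_prod] at hq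
  refine ⟨proj α S v q, hα.proj_mem hv q, ?_, fun j hj => ?_⟩
  · rw [← eval_retract]
    exact left_ne_zero_of_mul hq
  · rw [← eval_retract]
    exact Finset.prod_ne_zero_iff.1 (right_ne_zero_of_mul hq) j (Finset.mem_compl.2 hj)

/-- If `u ∏_{i ∈ S} α_i ^ L` lies in the ideal of the `α_i ^ (L + 1)`, `i ∈ S`, then `u` vanishes
on the flat of `S`. -/
lemma IsNormalCrossing.eval_eq_zero_of_prod_pow_mul_eq (hα : IsNormalCrossing α)
    {q : Fin n → ℂ} (hq : q ∈ flat α S) {L : ℕ} {u : MvPolynomial (Fin n) ℂ}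
    {f : Fin m → MvPolynomial (Fin n) ℂ}
    (h : (∏ i ∈ S, α i ^ L) * u = ∑ i ∈ S, α i ^ (L + 1) * f i) : eval q u = 0 := by
  classical
  obtain ⟨v, hv⟩ := hα.exists_dual hq
  -- Pullback along t ↦ q + ∑_{i ∈ S} t_i v_i turns α_k into X_k for k ∈ S. The coefficient of ∏_{i
  -- ∈ S} X_i^L is then u(q) on the left and 0 on the right.
  let σ : MvPolynomial (Fin n) ℂ →ₐ[ℂ] MvPolynomial (Fin m) ℂ :=
    aeval fun j => C (q j) + ∑ i ∈ S, X i * C (v i j)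
  have hσ : ∀ (t : Fin m → ℂ) g, eval t (σ g) = eval (q + ∑ i ∈ S, t i • v i) g := by
    intro t g
    induction g using MvPolynomial.induction_on with
    | C z => simp [σ]
    | add f g hf hg => simp [hf, hg]
    | mul_X f j hf =>
      rw [map_mul, map_mul, hf, map_mul]
      simp [σ]
  have hσα : ∀ k ∈ S, σ (α k) = X k := by
    intro k hk
    refine MvPolynomial.funext fun t => ?_
    rw [hσ, hα.eval_add, hq k hk, hv.lin_sum_smul hk, eval_X, zero_add]
  have h' := congrArg σ h
  simp only [map_mul, map_prod, map_sum, map_pow] at h'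
  rw [Finset.prod_congr rfl fun k hk => by rw [hσα k hk],
    Finset.sum_congr rfl fun k hk => by rw [hσα k hk]] at h'
  let d : Fin m →₀ ℕ := ∑ i ∈ S, Finsupp.single i L
  have hd : ∀ k ∈ S, d k = L := by
    intro k hk
    simp [d, Finsupp.finsetSum_apply, Finsupp.single_apply, hk]
  have hmon : ∏ i ∈ S, (X i : MvPolynomial (Fin m) ℂ) ^ L = monomial d 1 := by
    simp_rw [X_pow_eq_monomial, d, monomial_sum_one]
  have h0 : coeff d (∑ i ∈ S, X i ^ (L + 1) * σ (f i)) = 0 := by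
    rw [coeff_sum]
    refine Finset.sum_eq_zero fun k hk => ?_
    rw [X_pow_eq_monomial, coeff_monomial_mul', if_neg]
    intro hle
    have := hle k
    rw [hd k hk, Finsupp.single_eq_same] at this
    omega
  rw [← h', hmon] at h0
  have h1 : coeff d (monomial d 1 * σ u) = coeff 0 (σ u) := by
    simpa using coeff_monomial_mul 0 d (1 : ℂ) (σ u)
  rw [h1] at h0
  have h2 := hσ 0 u
  rw [eval_zero, constantCoeff_eq, h0] at h2
  simpa using h2.symm

end Geometry

/-! ### The submodules with prescribed poles -/

section Poles

variable {n m : ℕ} {α : Fin m → MvPolynomial (Fin n) ℂ} {β : Fin m → ℂ} {c : Fin m → ℤ}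

lemma smul_mono_mem {N : Submodule (WeylAlgebra n) (TwistedModule α β)} {a : Fin m → ℤ}
    {f : MvPolynomial (Fin n) ℂ} (h : mono α β c a f ∈ N) (g : MvPolynomial (Fin n) ℂ) :
    mono α β c a (g * f) ∈ N := by
  rw [← poly_smul_mono]
  exact N.smul_mem _ h

lemma mono_mem_of_le {N : Submodule (WeylAlgebra n) (TwistedModule α β)} {a b : Fin m → ℤ}
    (hab : b ≤ a) (h : mono α β c b 1 ∈ N) (f : MvPolynomial (Fin n) ℂ) :
    mono α β c a f ∈ N := by
  rw [mono_of_le hab, ← mul_one (_ * f)]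
  exact smul_mono_mem h _

lemma exists_mono_sum_eq {ι : Type*} (s : Finset ι) (b : Fin m → ℤ) (x : ι → TwistedModule α β)
    (hx : ∀ i ∈ s, ∃ g, x i = mono α β c b g) : ∃ g, ∑ i ∈ s, x i = mono α β c b g := by
  classical
  induction s using Finset.induction_on with
  | empty => exact ⟨0, by simp [mono_zero]⟩
  | insert i s hi ih =>
    obtain ⟨g, hg⟩ := ih fun j hj => hx j (Finset.mem_insert_of_mem hj)
    obtain ⟨h, hh⟩ := hx i (Finset.mem_insert_self _ _)
    exact ⟨h + g, by rw [Finset.sum_insert hi, hg, hh, mono_add]⟩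

variable (α β c) in
/-- The submodule of `M_α^β` of the elements which, relative to `∏ α_i ^ (-c_i) α^β`, have no poles
along the hyperplanes `H_i` with `β_i = c_i` and `i ∉ S`. -/
def poleSub (S : Finset (Fin m)) : Submodule (WeylAlgebra n) (TwistedModule α β) :=
  let N : AddSubgroup (TwistedModule α β) :=
    { carrier := {r | ∃ a f, (∀ i, β i = c i → i ∉ S → 0 ≤ a i) ∧ r = mono α β c a f}
      zero_mem' := ⟨0, 0, fun _ _ _ => le_rfl, by rw [mono_zero]⟩
      add_mem' := by
        rintro _ _ ⟨a, f, ha, rfl⟩ ⟨b, g, hb, rfl⟩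
        rw [mono_of_le (inf_le_left : a ⊓ b ≤ a), mono_of_le (inf_le_right : a ⊓ b ≤ b), ← mono_add]
        exact ⟨a ⊓ b, _, fun i h1 h2 => le_inf (ha i h1 h2) (hb i h1 h2), rfl⟩
      neg_mem' := by
        rintro _ ⟨a, f, ha, rfl⟩
        exact ⟨a, -f, ha, by rw [mono_neg]⟩ }
  { N with
    smul_mem' := by
      refine fun w r hr => smul_mem_of_poly_of_d N ?_ ?_ w r hr
      · rintro h _ ⟨a, f, ha, rfl⟩
        exact ⟨a, h * f, ha, poly_smul_mono _ _ _⟩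
      · rintro j _ ⟨a, f, ha, rfl⟩
        rw [d_smul_mono]
        refine N.add_mem ⟨a, _, ha, rfl⟩ (N.sum_mem fun i _ => ?_)
        -- The only case in which a forbidden pole could arise; the coefficient is then zero.
        by_cases h : β i = c i ∧ i ∉ S ∧ a i = 0
        · rw [h.1, h.2.2]
          simp only [Int.cast_zero, zero_sub, neg_add_cancel, C_0, zero_mul, mono_zero]
          exact N.zero_mem
        · refine ⟨_, _, fun k h1 h2 => ?_, rfl⟩
          rcases eq_or_ne k i with rfl | hk
          · have : a k ≠ 0 := fun h0 => h ⟨h1, h2, h0⟩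
            have := ha k h1 h2
            simp only [Pi.sub_apply, Pi.single_eq_same]
            omega
          · simpa [Pi.single_eq_of_ne hk] using ha k h1 h2 }

lemma mono_mem_poleSub {S : Finset (Fin m)} {a : Fin m → ℤ}
    (ha : ∀ i, β i = c i → i ∉ S → 0 ≤ a i) (f : MvPolynomial (Fin n) ℂ) :
    mono α β c a f ∈ poleSub α β c S := ⟨a, f, ha, rfl⟩

lemma poleSub_mono {S S' : Finset (Fin m)} (h : S ⊆ S') : poleSub α β c S ≤ poleSub α β c S' := by
  rintro _ ⟨a, f, ha, rfl⟩
  exact mono_mem_poleSub (fun i h1 h2 => ha i h1 fun h' => h2 (h h')) f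

lemma exists_pow_smul_mem_poleSub {S : Finset (Fin m)} {r : TwistedModule α β}
    (hr : r ∈ poleSub α β c S) (i : Fin m) :
    ∃ L : ℕ, polyToWeyl n (α i ^ L) • r ∈ poleSub α β c (S.erase i) := by
  classical
  obtain ⟨a, f, ha, rfl⟩ := hr
  refine ⟨(-a i).toNat, ?_⟩
  rw [poly_smul_mono, mono_mul_pow]
  refine mono_mem_poleSub (fun k h1 h2 => ?_) f
  rcases eq_or_ne k i with rfl | hk
  · simp only [Pi.add_apply, Pi.single_eq_same]
    omega
  · simpa [Pi.single_eq_of_ne hk] using ha k h1 fun h' => h2 (Finset.mem_erase.2 ⟨hk, h'⟩)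

lemma poleSub_eq_top {S : Finset (Fin m)} (hS : ∀ i, β i = c i → i ∈ S) :
    poleSub α β c S = ⊤ := by
  refine eq_top_iff.2 fun r _ => ?_
  obtain ⟨a, f, rfl⟩ := exists_mono_eq (c := c) r
  exact mono_mem_poleSub (fun i h1 h2 => absurd (hS i h1) h2) f

variable (β c) in
/-- Exponents which vanish at the `i ∉ S` with `β_i = c_i` and are negative on `S`. -/
structure IsPolar (S : Finset (Fin m)) (a : Fin m → ℤ) : Prop where
  eq_zero : ∀ i, β i = c i → i ∉ S → a i = 0
  neg : ∀ i ∈ S, a i ≤ -1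

lemma exists_isPolar_of_mem_poleSub {S : Finset (Fin m)} {r : TwistedModule α β}
    (hr : r ∈ poleSub α β c S) : ∃ a f, IsPolar β c S a ∧ r = mono α β c a f := by
  classical
  obtain ⟨a, f, ha, rfl⟩ := hr
  have h : (fun i => if i ∈ S then min (a i) (-1) else if β i = c i then 0 else a i) ≤ a := by
    intro i
    by_cases h1 : i ∈ S
    · simp [h1]
    · by_cases h2 : β i = c i
      · simpa [h1, h2] using ha i h2 h1
      · simp [h1, h2]
  refine ⟨_, _, ⟨fun i h1 h2 => ?_, fun i h1 => ?_⟩, mono_of_le h f⟩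
  · simp [h1, h2]
  · simp [h1]

/-- Each summand has no pole along its own H_i, so over the denominator with exponent L everywhere
its numerator is divisible by α_i^L. All large L are allowed so that other elements fit over the
same denominator. -/
lemma mem_iSup_poleSub {S : Finset (Fin m)} (hS : ∀ i ∈ S, β i = c i) {r : TwistedModule α β}
    (hr : r ∈ ⨆ i ∈ S, poleSub α β c (Finset.univ.erase i)) :
    ∃ L₀ : ℕ, ∀ L ≥ L₀, ∃ f : Fin m → MvPolynomial (Fin n) ℂ,
      r = mono α β c (fun _ => -(L : ℤ)) (∑ i ∈ S, α i ^ L * f i) := by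
  classical
  obtain ⟨μ, rfl⟩ := (Submodule.mem_iSup_finset_iff_exists_sum _ _).1 hr
  have key : ∀ i : Fin m, ∃ L₀ : ℕ, i ∈ S → ∀ L ≥ L₀, ∃ f : MvPolynomial (Fin n) ℂ,
      (μ i : TwistedModule α β) = mono α β c (fun _ => -(L : ℤ)) (α i ^ L * f) := by
    intro i
    by_cases hi : i ∈ S
    swap
    · exact ⟨0, fun h => absurd h hi⟩
    obtain ⟨a, f, ha, h⟩ := (μ i).2
    refine ⟨∑ k, (a k).natAbs, fun _ L hL => ?_⟩
    have hle : ∀ k, -(L : ℤ) ≤ a k := fun k => by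
      have := Finset.single_le_sum (f := fun k => (a k).natAbs) (fun _ _ => Nat.zero_le _)
        (Finset.mem_univ k)
      omega
    have hle' : (fun _ => -(L : ℤ)) + Pi.single i (L : ℤ) ≤ a := by
      intro k
      rcases eq_or_ne k i with rfl | hk
      · simpa using ha k (hS k hi) (by simp)
      · simpa [Pi.single_eq_of_ne hk] using hle k
    exact ⟨_, by rw [h, mono_of_le hle', ← mono_mul_pow]⟩
  choose L₀ hL₀ using key
  refine ⟨∑ i, L₀ i, fun L hL => ?_⟩
  have hL' : ∀ i, L₀ i ≤ L := fun i =>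
    (Finset.single_le_sum (f := L₀) (fun _ _ => Nat.zero_le _) (Finset.mem_univ i)).trans hL
  have : ∀ i, ∃ f : MvPolynomial (Fin n) ℂ, i ∈ S →
      (μ i : TwistedModule α β) = mono α β c (fun _ => -(L : ℤ)) (α i ^ L * f) := by
    intro i
    by_cases hi : i ∈ S
    · obtain ⟨f, hf⟩ := hL₀ i hi L (hL' i)
      exact ⟨f, fun _ => hf⟩
    · exact ⟨0, fun h => absurd h hi⟩
  choose f hf using this
  exact ⟨f, by rw [mono_sum]; exact Finset.sum_congr rfl fun i hi => hf i hi⟩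

/-- The residue along the flat of `S` of an element with at most simple poles along `H_i`, `i ∈ S`,
vanishes if the element is a sum of elements without pole along one of the `H_i`. -/
lemma IsNormalCrossing.eval_eq_zero_of_mono_mem (hα : IsNormalCrossing α) {S : Finset (Fin m)}
    (hS : ∀ i ∈ S, β i = c i) {a : Fin m → ℤ} (ha : ∀ i ∈ S, a i = -1)
    {g : MvPolynomial (Fin n) ℂ}
    (hg : mono α β c a g ∈ ⨆ i ∈ S, poleSub α β c (Finset.univ.erase i)) {q : Fin n → ℂ}
    (hq : q ∈ flat α S) : eval q g = 0 := by
  classical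
  by_contra hne
  -- Clearing denominators will introduce powers of α_j, j ∉ S; the new point is chosen so that they
  -- do not vanish there.
  obtain ⟨q, hq, hqg, hqα⟩ := hα.exists_generic ⟨q, hq, hne⟩
  obtain ⟨L₀, h⟩ := mem_iSup_poleSub hS hg
  -- With denominator exponent L + 1, a simple pole leaves α_i^L on the left against α_i^(L + 1) on
  -- the right.
  obtain ⟨f, hf⟩ := h (L₀ + ∑ k, (a k).natAbs + 1) (by omega)
  set L := L₀ + ∑ k, (a k).natAbs with hL
  have hle : (fun _ => -((L + 1 : ℕ) : ℤ)) ≤ a := fun k => by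
    have := Finset.single_le_sum (f := fun k => (a k).natAbs) (fun _ _ => Nat.zero_le _)
      (Finset.mem_univ k)
    simp only at this ⊢
    omega
  rw [mono_of_le hle] at hf
  have hf' := mono_injective hα.ne_zero _ hf
  rw [← Finset.prod_mul_prod_compl S, mul_assoc] at hf'
  have hpow : ∏ i ∈ S, α i ^ (a i - -((L + 1 : ℕ) : ℤ)).toNat = ∏ i ∈ S, α i ^ L := by
    refine Finset.prod_congr rfl fun i hi => ?_
    congr 1
    rw [ha i hi]
    omega
  rw [hpow] at hf'
  have := hα.eval_eq_zero_of_prod_pow_mul_eq hq hf'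
  rw [map_mul, map_prod] at this
  refine mul_ne_zero (Finset.prod_ne_zero_iff.2 fun j hj => ?_) hqg this
  rw [map_pow]
  exact pow_ne_zero _ (hqα j (Finset.mem_compl.1 hj))

/-- Modulo the elements without pole along one of the `H_i`, `i ∈ S`, pole orders can be lowered
to one. -/
lemma IsNormalCrossing.exists_simple_pole (hα : IsNormalCrossing α) {S : Finset (Fin m)}
    (hS : ∀ i ∈ S, β i = c i) (hne : (flat α S).Nonempty)
    {K N : Submodule (WeylAlgebra n) (TwistedModule α β)} (hKN : K ≤ N)
    (a : Fin m → ℤ) (f : MvPolynomial (Fin n) ℂ) (ha : IsPolar β c S a)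
    (hN : mono α β c a f ∈ N) (hK : mono α β c a f ∉ K) :
    ∃ a' g, IsPolar β c S a' ∧ (∀ i ∈ S, a' i = -1) ∧
      mono α β c a' g ∈ N ∧ mono α β c a' g ∉ K := by
  classical
  obtain ⟨p, hp⟩ := hne
  obtain ⟨v, hv⟩ := hα.exists_dual hp
  induction hd : ∑ i ∈ S, (-a i - 1).toNat using Nat.strong_induction_on generalizing a f with
  | _ d ih =>
  by_cases h1 : ∀ i ∈ S, a i = -1
  · exact ⟨a, f, ha, h1, hN, hK⟩
  push Not at h1
  obtain ⟨i, hi, hai⟩ := h1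
  have hai2 : a i ≤ -2 := by have := ha.neg i hi; omega
  have hlt : ∀ b : Fin m → ℤ, (∀ k ∈ S, b k = a k + if k = i then 1 else 0) →
      ∑ k ∈ S, (-b k - 1).toNat < d := by
    intro b hb
    rw [← hd]
    refine Finset.sum_lt_sum (fun k hk => ?_) ⟨i, hi, ?_⟩
    · rw [hb k hk]; split_ifs <;> omega
    · rw [hb i hi, if_pos rfl]; omega
  -- If multiplying by α_i stays outside K, a pole order has dropped. Otherwise differentiate the
  -- product along v_i inside K: this gives (1 + a_i) times the original element plus terms of
  -- smaller pole order along H_i.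
  by_cases h2 : mono α β c a (α i * f) ∈ K
  swap
  · rw [mono_mul] at h2
    have hb : ∀ k, (a + Pi.single i 1 : Fin m → ℤ) k = a k + if k = i then 1 else 0 := fun k => by
      simp [Pi.single_apply]
    refine ih _ (hlt _ fun k _ => hb k) (a + Pi.single i 1) f ⟨fun k hk hkS => ?_, fun k hk => ?_⟩
      ?_ h2 rfl
    · rw [hb, ha.eq_zero k hk hkS, if_neg, add_zero]
      rintro rfl
      exact hkS hi
    · rw [hb]
      split_ifs with h
      · subst h; omega
      · simpa using ha.neg k hk
    · rw [← mono_mul]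
      exact smul_mono_mem hN _
  -- Common exponents for the remaining terms: one pole fewer along H_i, one more allowed along each
  -- nonresonant hyperplane. Other resonant k contribute nothing, either because v_i is tangent to
  -- H_k or because a_k = 0.
  let b : Fin m → ℤ := fun k => a k + (if k = i then 1 else 0) - if β k = c k then 0 else 1
  have hbS : ∀ k ∈ S, b k = a k + if k = i then 1 else 0 := fun k hk => by simp [b, hS k hk]
  have hba : b ≤ a + Pi.single i 1 := fun k => by
    simp only [b, Pi.add_apply, Pi.single_apply]
    split_ifs <;> omega
  have hbk : ∀ k, β k ≠ c k → b ≤ a - Pi.single k 1 + Pi.single i 1 := fun k hk l => by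
    simp only [b, Pi.add_apply, Pi.sub_apply, Pi.single_apply]
    by_cases hlk : l = k
    · subst hlk; simp only [hk, if_false, if_true]; omega
    · simp only [hlk, if_false]; split_ifs <;> omega
  have h3 := K.smul_mem (weylD (v i)) h2
  rw [weylD_smul_mono, Derivation.leibniz, mono_add, ← Finset.add_sum_erase _ _ (Finset.mem_univ i),
    hα.polyD_eq, hv i hi i hi, if_pos rfl, C_1, smul_eq_mul, smul_eq_mul, mul_one, mul_one] at h3
  have h4 : mono α β c (a - Pi.single i 1) (C ((a i : ℂ) - c i + β i) * (α i * f))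
      = mono α β c a (C (a i : ℂ) * f) := by
    rw [mul_left_comm, mono_mul, sub_add_cancel, hS i hi, sub_add_cancel]
  rw [h4] at h3
  obtain ⟨g₁, hg₁⟩ : ∃ g, mono α β c a (α i * polyD (v i) f) = mono α β c b g :=
    ⟨_, by rw [mono_mul, mono_of_le hba]⟩
  obtain ⟨g₂, hg₂⟩ := exists_mono_sum_eq (c := c) (Finset.univ.erase i) b (fun k =>
    mono α β c (a - Pi.single k 1) (C ((a k : ℂ) - c k + β k) * polyD (v i) (α k) * (α i * f)))
    (fun k hk => by
      by_cases hkc : β k = c k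
      · refine ⟨0, ?_⟩
        rw [mono_zero]
        by_cases hkS : k ∈ S
        · rw [hα.polyD_eq, hv i hi k hkS, if_neg (Finset.ne_of_mem_erase hk)]
          simp [mono_zero]
        · rw [ha.eq_zero k hkc hkS, hkc]
          simp [mono_zero]
      · exact ⟨_, (congrArg _ (mul_left_comm _ _ _)).trans
          ((mono_mul _ _ _).trans (mono_of_le (hbk k hkc) _))⟩)
  rw [hg₁, hg₂] at h3
  have h5 : mono α β c b (g₁ + g₂) + mono α β c a (C (1 + a i : ℂ) * f) ∈ K := by
    rw [mono_add, C_add, add_mul, C_1, one_mul, mono_add]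
    convert! h3 using 1
    abel
  -- Here a_i ≤ -2 is essential: simple poles cannot be removed this way.
  have h6 : (1 + a i : ℂ) ≠ 0 := by
    intro h
    have : (1 + a i : ℤ) = 0 := by exact_mod_cast h
    omega
  have h7 : mono α β c b (C (1 + a i : ℂ)⁻¹ * (g₁ + g₂)) + mono α β c a f ∈ K := by
    have := K.smul_mem (polyToWeyl n (C (1 + a i : ℂ)⁻¹)) h5
    rwa [smul_add, poly_smul_mono, poly_smul_mono, ← mul_assoc, ← C_mul, inv_mul_cancel₀ h6, C_1,
      one_mul] at this
  refine ih _ (hlt b hbS) b (C (1 + a i : ℂ)⁻¹ * (g₁ + g₂)) ⟨fun k hk hkS => ?_, fun k hk => ?_⟩ ?_ ?_ rfl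
  · have : k ≠ i := by rintro rfl; exact hkS hi
    simp [b, hk, this, ha.eq_zero k hk hkS]
  · rw [hbS k hk]
    split_ifs with h
    · subst h; omega
    · simpa using ha.neg k hk
  · exact (N.add_mem_iff_left hN).1 (hKN h7)
  · exact fun h => hK ((K.add_mem_iff_right h).1 h7)

end Poles

/-! ### Simplicity -/

section PolynomialLemmas

variable {n : ℕ}

/-- The Nullstellensatz, which lets membership in a submodule be checked point by point. -/
lemma ideal_eq_top_of_forall_exists_eval_ne_zero (J : Ideal (MvPolynomial (Fin n) ℂ))
    (h : ∀ p : Fin n → ℂ, ∃ f ∈ J, eval p f ≠ 0) : J = ⊤ := by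
  by_contra hJ
  obtain ⟨M, hM, hJM⟩ := Ideal.exists_le_maximal J hJ
  obtain ⟨p, rfl⟩ := isMaximal_iff_eq_vanishingIdeal_singleton.1 hM
  obtain ⟨f, hf, hne⟩ := h p
  refine hne ?_
  have := (mem_vanishingIdeal_singleton_iff (k := ℂ) p f).1 (hJM hf)
  rw [← coe_aeval_eq_eval]
  exact this

lemma exists_pderiv_ne_zero {f : MvPolynomial (Fin n) ℂ} (hf : f.totalDegree ≠ 0) :
    ∃ j, pderiv j f ≠ 0 := by
  have : ∃ d ∈ f.support, d ≠ 0 := by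
    by_contra! h
    refine hf (totalDegree_eq_zero_iff_eq_C.2 ?_)
    ext d
    rw [coeff_C]
    split_ifs with hd
    · rw [hd]
    · by_contra hne
      exact hd (h d (mem_support_iff.2 hne)).symm
  obtain ⟨d, hd, hd0⟩ := this
  obtain ⟨j, hj⟩ := Finsupp.ne_iff.1 hd0
  refine ⟨j, fun h => ?_⟩
  have h1 := congrArg (coeff (d - Finsupp.single j 1)) h
  have h2 : d - Finsupp.single j 1 + Finsupp.single j 1 = d :=
    tsub_add_cancel_of_le (Finsupp.single_le_iff.2 (Nat.one_le_iff_ne_zero.2 hj))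
  rw [coeff_pderiv, h2, coeff_zero] at h1
  refine mul_ne_zero (mem_support_iff.1 hd) ?_ h1
  exact Nat.cast_add_one_ne_zero _

lemma totalDegree_pderiv_lt {f : MvPolynomial (Fin n) ℂ} (hf : f.totalDegree ≠ 0) (j : Fin n) :
    (pderiv j f).totalDegree < f.totalDegree := by
  refine (Finset.sup_lt_iff (Nat.pos_of_ne_zero hf)).2 fun d hd => ?_
  rw [mem_support_iff, coeff_pderiv] at hd
  have h : (d + Finsupp.single j 1).degree ≤ f.totalDegree :=
    le_totalDegree (mem_support_iff.2 (left_ne_zero_of_mul hd))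
  rw [map_add, Finsupp.degree_single] at h
  exact h

end PolynomialLemmas

/-! ### Simplicity of the successive quotients -/

section Simple

variable {n m : ℕ} {α : Fin m → MvPolynomial (Fin n) ℂ} {β : Fin m → ℂ} {c : Fin m → ℤ}

/-- The ideal of the polynomials `g` with `g ∏ α_i ^ (a_i - c_i) α^β ∈ N`. -/
def coeffIdeal (c : Fin m → ℤ) (N : Submodule (WeylAlgebra n) (TwistedModule α β)) (a : Fin m → ℤ) :
    Ideal (MvPolynomial (Fin n) ℂ) where
  carrier := {g | mono α β c a g ∈ N}
  zero_mem' := by simp [mono_zero]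
  add_mem' := fun hf hg => by
    simp only [Set.mem_ofPred_eq, mono_add] at hf hg ⊢
    exact N.add_mem hf hg
  smul_mem' := fun f g hg => smul_mono_mem hg f

lemma mem_coeffIdeal {N : Submodule (WeylAlgebra n) (TwistedModule α β)} {a : Fin m → ℤ}
    {g : MvPolynomial (Fin n) ℂ} : g ∈ coeffIdeal c N a ↔ mono α β c a g ∈ N := Iff.rfl

variable (α β c) in
/-- The product of the `α_i` with `β_i ≠ c_i`. -/
def nonresProd : MvPolynomial (Fin n) ℂ :=
  open scoped Classical in ∏ i with β i ≠ c i, α i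

/-- The coefficient ideals are stable under the vector fields `γ ∂_w`, for `w` tangent to the flat
and `γ` the product of the `α_i` with `β_i ≠ c_i`. -/
lemma IsNormalCrossing.nonresProd_mul_polyD_mem (hα : IsNormalCrossing α) {S : Finset (Fin m)}
    {N : Submodule (WeylAlgebra n) (TwistedModule α β)} {a : Fin m → ℤ} (ha : IsPolar β c S a)
    {g : MvPolynomial (Fin n) ℂ} (hg : g ∈ coeffIdeal c N a) {w : Fin n → ℂ}
    (hw : ∀ k ∈ S, lin α k w = 0) : nonresProd α β c * polyD w g ∈ coeffIdeal c N a := by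
  classical
  have h := N.smul_mem (polyToWeyl n (nonresProd α β c)) (N.smul_mem (weylD w) hg)
  rw [weylD_smul_mono, smul_add, poly_smul_mono] at h
  refine (N.add_mem_iff_left ?_).1 h
  rw [Finset.smul_sum]
  refine N.sum_mem fun k _ => ?_
  rw [poly_smul_mono, hα.polyD_eq]
  by_cases hkc : β k = c k
  · have : mono α β c (a - Pi.single k 1) (nonresProd α β c *
        (C ((a k : ℂ) - c k + β k) * C (lin α k w) * g)) = 0 := by
      by_cases hkS : k ∈ S
      · rw [hw k hkS]
        simp [mono_zero]
      · rw [ha.eq_zero k hkc hkS, hkc]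
        simp [mono_zero]
    rw [this]
    exact N.zero_mem
  · obtain ⟨γ, hγ⟩ : α k ∣ nonresProd α β c := by
      unfold nonresProd
      exact Finset.dvd_prod_of_mem α (by simpa using hkc)
    rw [hγ, mul_assoc, mono_mul, sub_add_cancel, ← mul_assoc]
    exact smul_mono_mem hg _

/-- Differentiating along the flat lowers the degree of h at the price of powers of γ, until h is a
nonzero constant. -/
lemma IsNormalCrossing.exists_nonresProd_pow_mem_of_polyD_eq_zero (hα : IsNormalCrossing α)
    {S : Finset (Fin m)} {v : Fin m → Fin n → ℂ} (hv : IsDual α S v)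
    {N : Submodule (WeylAlgebra n) (TwistedModule α β)} {a : Fin m → ℤ} (ha : IsPolar β c S a)
    (h : MvPolynomial (Fin n) ℂ) (h0 : h ≠ 0) (hh : ∀ i ∈ S, polyD (v i) h = 0) (l : ℕ)
    (hl : nonresProd α β c ^ l * h ∈ coeffIdeal c N a) :
    ∃ k, nonresProd α β c ^ k ∈ coeffIdeal c N a := by
  classical
  induction hd : h.totalDegree using Nat.strong_induction_on generalizing h l with
  | _ d ih =>
  set γ := nonresProd α β c
  by_cases hdeg : h.totalDegree = 0
  · rw [totalDegree_eq_zero_iff_eq_C] at hdeg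
    have hz : coeff 0 h ≠ 0 := fun hz => h0 (by rw [hdeg, hz, C_0])
    refine ⟨l, ?_⟩
    have := Ideal.mul_mem_left _ (C (coeff 0 h)⁻¹) hl
    rwa [hdeg, coeff_zero_C, mul_left_comm, ← C_mul, inv_mul_cancel₀ hz, C_1, mul_one] at this
  obtain ⟨j, hj⟩ := exists_pderiv_ne_zero hdeg
  refine ih _ (hd ▸ totalDegree_pderiv_lt hdeg j) (pderiv j h) hj (fun i hi => ?_) (l + 2) ?_ rfl
  · have h1 := congrArg (pderiv j) (hh i hi)
    rw [map_zero] at h1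
    rw [← h1, polyD_apply, polyD_apply, map_sum]
    refine Finset.sum_congr rfl fun k _ => ?_
    rw [pderiv_C_mul, pderiv_pderiv_comm]
  -- The j-th basis vector corrected to be tangent to the flat; as h is constant along the v_i, ∂_w
  -- h = ∂_j h.
  · let w : Fin n → ℂ := Pi.single j 1 + -∑ i ∈ S, lin α i (Pi.single j 1) • v i
    have hw : ∀ k ∈ S, lin α k w = 0 := fun k hk => by
      rw [lin_add, lin_neg, hv.lin_sum_smul hk, add_neg_cancel]
    have hwh : polyD w h = pderiv j h := by
      have : polyD w h = polyD (Pi.single j 1) h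
          - ∑ i ∈ S, C (lin α i (Pi.single j 1)) * polyD (v i) h := by
        have hwx : ∀ x, C (w x) = C ((Pi.single j 1 : Fin n → ℂ) x)
            - ∑ i ∈ S, C (lin α i (Pi.single j 1)) * (C (v i x) : MvPolynomial (Fin n) ℂ) := by
          intro x
          simp [w, sub_eq_add_neg]
        simp only [polyD_apply, hwx, sub_mul, Finset.sum_sub_distrib, Finset.sum_mul,
          Finset.mul_sum, mul_assoc]
        rw [Finset.sum_comm]
      rw [this, polyD_single, Finset.sum_eq_zero, sub_zero]
      intro i hi
      rw [hh i hi, mul_zero]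
    have h1 : γ ^ (l + 1) * h ∈ coeffIdeal c N a := by
      rw [pow_succ', mul_assoc]
      exact Ideal.mul_mem_left _ _ hl
    have h2 := hα.nonresProd_mul_polyD_mem ha h1 hw
    rw [Derivation.leibniz, Derivation.leibniz_pow, hwh] at h2
    have h3 : γ ^ (l + 2) * pderiv j h = γ * (γ ^ (l + 1) • pderiv j h +
        h • ((l + 1) • γ ^ (l + 1 - 1) • polyD w γ)) - ((l + 1) • (γ * polyD w γ)) * (γ ^ l * h) := by
      simp only [smul_eq_mul, nsmul_eq_mul, Nat.add_sub_cancel]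
      ring
    rw [h3]
    exact Ideal.sub_mem _ h2 (Ideal.mul_mem_left _ _ hl)

/-- An element with simple poles along `H_i`, `i ∈ S`, and nonzero residue along the flat of `S`
generates an element with constant residue. -/
lemma IsNormalCrossing.exists_nonresProd_pow_mem (hα : IsNormalCrossing α) {S : Finset (Fin m)}
    (hne : (flat α S).Nonempty)
    {K N : Submodule (WeylAlgebra n) (TwistedModule α β)} (hKN : K ≤ N)
    (hK : ∀ i ∈ S, poleSub α β c (S.erase i) ≤ K)
    {a : Fin m → ℤ} (ha : IsPolar β c S a) (ha1 : ∀ i ∈ S, a i = -1)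
    {g : MvPolynomial (Fin n) ℂ} (hgN : g ∈ coeffIdeal c N a) (hgK : g ∉ coeffIdeal c K a) :
    ∃ k, nonresProd α β c ^ k ∈ coeffIdeal c N a := by
  classical
  obtain ⟨p, hp⟩ := hne
  obtain ⟨v, hv⟩ := hα.exists_dual hp
  have hspan : Ideal.span (α '' S) ≤ coeffIdeal c K a := by
    rw [Ideal.span_le]
    rintro _ ⟨i, hi, rfl⟩
    have hi : i ∈ S := hi
    refine hK i hi ?_
    rw [← mul_one (α i), mono_mul]
    refine mono_mem_poleSub (fun k hk hkS => ?_) 1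
    rcases eq_or_ne k i with rfl | hki
    · simp [ha1 k hi]
    · have : k ∉ S := fun h => hkS (Finset.mem_erase.2 ⟨hki, h⟩)
      simp [Pi.single_eq_of_ne hki, ha.eq_zero k hk this]
  have hr := hspan (sub_retract_mem (v := v) g)
  refine hα.exists_nonresProd_pow_mem_of_polyD_eq_zero hv ha (retract α S v g) (fun h0 => ?_)
    (fun i hi => hα.polyD_retract hv hi g) 0 ?_
  · rw [h0, sub_zero] at hr
    exact hgK hr
  · rw [pow_zero, one_mul]
    have := Ideal.sub_mem _ hgN (hKN hr : _ ∈ coeffIdeal c N a)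
    rwa [sub_sub_cancel] at this

/-- The pole orders along the hyperplanes of `S` and those with nonintegral exponents can be
increased. -/
lemma IsNormalCrossing.mono_sub_single_mem (hα : IsNormalCrossing α)
    (hc : ∀ i, β i ≠ c i → ∀ k : ℤ, β i ≠ k)
    {S : Finset (Fin m)} (hS : ∀ i ∈ S, β i = c i)
    {N : Submodule (WeylAlgebra n) (TwistedModule α β)}
    (hN : ∀ i ∈ S, poleSub α β c (S.erase i) ≤ N)
    {a : Fin m → ℤ} (ha : IsPolar β c S a) (h : mono α β c a 1 ∈ N) {i : Fin m}
    (hi : i ∈ S ∨ β i ≠ c i) : mono α β c (a - Pi.single i 1) 1 ∈ N := by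
  classical
  have hJ : coeffIdeal c N (a - Pi.single i 1) = ⊤ := by
    -- Off H_i, α_i works. Off the flat of S, a power of some α_k removes the pole along H_k. At the
    -- remaining points, differentiate in the direction dual to α_i.
    refine ideal_eq_top_of_forall_exists_eval_ne_zero _ fun p => ?_
    by_cases hpi : eval p (α i) = 0
    swap
    · refine ⟨α i, ?_, hpi⟩
      rw [mem_coeffIdeal, ← mul_one (α i), mono_mul, sub_add_cancel]
      exact h
    by_cases hpS : p ∈ flat α S
    swap
    · obtain ⟨k, hk, hpk⟩ : ∃ k ∈ S, eval p (α k) ≠ 0 := by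
        simpa [flat] using hpS
      -- The extra 1 covers k = i, where the pole order has just been increased.
      refine ⟨α k ^ (-(a k) + 1).toNat, ?_, by rw [map_pow]; exact pow_ne_zero _ hpk⟩
      rw [mem_coeffIdeal, ← mul_one (α k ^ _), mono_mul_pow]
      refine hN k hk (mono_mem_poleSub (fun l hl hlS => ?_) 1)
      rcases eq_or_ne l k with rfl | hlk
      · simp only [Pi.add_apply, Pi.sub_apply, Pi.single_apply, if_true]
        split_ifs <;> omega
      · have hlS' : l ∉ S := fun h => hlS (Finset.mem_erase.2 ⟨hlk, h⟩)
        have hli : l ≠ i := by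
          rintro rfl
          exact hi.elim hlS' fun h => h hl
        simp [Pi.single_eq_of_ne hlk, Pi.single_eq_of_ne hli, ha.eq_zero l hl hlS']
    let Z : Finset (Fin m) := Finset.univ.filter fun k => eval p (α k) = 0
    have hpZ : p ∈ flat α Z := fun k hk => (Finset.mem_filter.1 hk).2
    have hiZ : i ∈ Z := by simp [Z, hpi]
    obtain ⟨v, hv⟩ := hα.exists_dual hpZ
    -- Among the hyperplanes through p, ∂_{v_i} sees only H_i; f clears the new poles along those
    -- avoiding p.
    let f := ∏ k ∈ Zᶜ, α k
    refine ⟨f, ?_, ?_⟩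
    swap
    · rw [map_prod]
      exact Finset.prod_ne_zero_iff.2 fun k hk => by simpa [Z] using hk
    have h1 := N.smul_mem (polyToWeyl n f) (N.smul_mem (weylD (v i)) h)
    have h0 : polyD (v i) 1 = 0 := (polyD (v i)).map_one_eq_zero
    rw [weylD_smul_mono, h0, mono_zero, zero_add, Finset.smul_sum,
      ← Finset.add_sum_erase _ _ (Finset.mem_univ i), poly_smul_mono, hα.polyD_eq,
      hv i hiZ i hiZ, if_pos rfl, C_1, mul_one, mul_one] at h1
    have h2 := (N.add_mem_iff_left (N.sum_mem fun k hk => ?_)).1 h1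
    · have hne : (a i : ℂ) - c i + β i ≠ 0 := by
        rcases hi with hi | hi
        · rw [hS i hi, sub_add_cancel]
          have := ha.neg i hi
          exact_mod_cast (by omega : a i ≠ 0)
        · intro h0
          refine hc i hi (c i - a i) ?_
          push_cast
          linear_combination h0
      have h3 := smul_mono_mem h2 (C ((a i : ℂ) - c i + β i)⁻¹)
      rwa [mul_left_comm, ← C_mul, inv_mul_cancel₀ hne, C_1, mul_one] at h3
    · rw [poly_smul_mono, hα.polyD_eq]
      by_cases hkZ : k ∈ Z
      · rw [hv i hiZ k hkZ, if_neg (Finset.ne_of_mem_erase hk)]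
        simp [mono_zero]
      · obtain ⟨γ, hγ⟩ : α k ∣ f := Finset.dvd_prod_of_mem α (Finset.mem_compl.2 hkZ)
        rw [hγ, mul_assoc, mono_mul, sub_add_cancel, ← mul_assoc]
        exact smul_mono_mem h _
  have : (1 : MvPolynomial (Fin n) ℂ) ∈ coeffIdeal c N (a - Pi.single i 1) := by
    rw [hJ]; trivial
  exact this

lemma IsNormalCrossing.mono_mem_of_isPolar (hα : IsNormalCrossing α)
    (hc : ∀ i, β i ≠ c i → ∀ k : ℤ, β i ≠ k)
    {S : Finset (Fin m)} (hS : ∀ i ∈ S, β i = c i)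
    {N : Submodule (WeylAlgebra n) (TwistedModule α β)}
    (hN : ∀ i ∈ S, poleSub α β c (S.erase i) ≤ N)
    {a : Fin m → ℤ} (ha : IsPolar β c S a) (h : mono α β c a 1 ∈ N)
    {b : Fin m → ℤ} (hb : IsPolar β c S b) (hba : b ≤ a) : mono α β c b 1 ∈ N := by
  classical
  induction hd : ∑ i, (a i - b i).toNat generalizing a with
  | zero =>
    have : a = b := by
      funext i
      have h1 : (a i - b i).toNat = 0 := Finset.sum_eq_zero_iff.1 hd i (Finset.mem_univ i)
      have h2 : b i ≤ a i := hba i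
      omega
    rwa [← this]
  | succ d ih =>
    obtain ⟨i, -, hi⟩ : ∃ i ∈ Finset.univ, (a i - b i).toNat ≠ 0 := by
      by_contra! h0
      rw [Finset.sum_eq_zero h0] at hd
      omega
    have hi' : i ∈ S ∨ β i ≠ c i := by
      by_contra! h0
      rw [ha.eq_zero i h0.2 h0.1, hb.eq_zero i h0.2 h0.1] at hi
      simp at hi
    refine ih (a := a - Pi.single i 1) ⟨fun k hk hkS => ?_, fun k hk => ?_⟩
      (hα.mono_sub_single_mem hc hS hN ha h hi') (fun k => ?_) ?_
    · have : k ≠ i := by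
        rintro rfl
        exact hi'.elim hkS fun h => h hk
      simp [Pi.single_eq_of_ne this, ha.eq_zero k hk hkS]
    · have := ha.neg k hk
      simp only [Pi.sub_apply, Pi.single_apply]
      split_ifs <;> omega
    · have := hba k
      rcases eq_or_ne k i with rfl | hki
      · simp only [Pi.sub_apply, Pi.single_eq_same]
        omega
      · simpa [Pi.single_eq_of_ne hki] using this
    · rw [← Finset.add_sum_erase _ _ (Finset.mem_univ i)] at hd ⊢
      rw [Finset.sum_congr rfl fun k hk => by
        rw [Pi.sub_apply, Pi.single_eq_of_ne (Finset.ne_of_mem_erase hk), sub_zero]]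
      simp only [Pi.sub_apply, Pi.single_eq_same]
      omega

/-- If `K` contains the `poleSub` of the proper subsets of `S` and consists of elements without
residue along the flat of `S`, then `poleSub` of `S` is simple modulo `K`. -/
lemma IsNormalCrossing.covBy_sup_poleSub (hα : IsNormalCrossing α)
    (hc : ∀ i, β i ≠ c i → ∀ k : ℤ, β i ≠ k)
    {S : Finset (Fin m)} (hS : ∀ i ∈ S, β i = c i) (hne : (flat α S).Nonempty)
    {K : Submodule (WeylAlgebra n) (TwistedModule α β)}
    (hK : ∀ i ∈ S, poleSub α β c (S.erase i) ≤ K)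
    (hK' : K ≤ ⨆ i ∈ S, poleSub α β c (Finset.univ.erase i)) :
    K ⋖ K ⊔ poleSub α β c S := by
  classical
  refine ⟨lt_of_le_of_ne le_sup_left fun h => ?_, fun N hKN hN => ?_⟩
  · obtain ⟨p, hp⟩ := hne
    -- Simple poles along S with residue 1.
    let a : Fin m → ℤ := fun i => if i ∈ S then -1 else 0
    have h1 : mono α β c a 1 ∈ poleSub α β c S :=
      mono_mem_poleSub (fun i _ hi => by simp [a, hi]) 1
    have h2 : mono α β c a 1 ∈ K := by
      rw [h]
      exact Submodule.mem_sup_right h1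
    have := hα.eval_eq_zero_of_mono_mem hS (fun i hi => by simp [a, hi]) (hK' h2) hp
    simp at this
  · refine hN.not_ge (sup_le hKN.le ?_)
    obtain ⟨x, hxN, hxK⟩ := SetLike.exists_of_lt hKN
    obtain ⟨y, hy, z, hz, rfl⟩ := Submodule.mem_sup.1 (hN.le hxN)
    obtain ⟨a, f, ha, rfl⟩ := exists_isPolar_of_mem_poleSub hz
    obtain ⟨a, g, ha, ha1, hgN, hgK⟩ := hα.exists_simple_pole hS hne hKN.le a f ha
      ((N.add_mem_iff_right (hKN.le hy)).1 hxN) (fun h => hxK (K.add_mem hy h))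
    obtain ⟨k, hk⟩ := hα.exists_nonresProd_pow_mem hne hKN.le hK ha ha1 hgN hgK
    -- Absorbs γ^k into the exponents of the nonresonant α_i, leaving numerator 1.
    let b : Fin m → ℤ := fun i => a i + if β i = c i then 0 else k
    have hab : a ≤ b := fun i => by
      simp only [b]
      split_ifs <;> omega
    have hb : IsPolar β c S b := by
      refine ⟨fun i hi hiS => ?_, fun i hi => ?_⟩
      · simp [b, hi, ha.eq_zero i hi hiS]
      · simpa [b, hS i hi] using ha.neg i hi
    have hbN : mono α β c b 1 ∈ N := by
      have hγ : ∏ i, α i ^ (b i - a i).toNat = nonresProd α β c ^ k := by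
        rw [nonresProd, Finset.prod_filter, ← Finset.prod_pow (Finset.univ : Finset (Fin m)) k]
        refine Finset.prod_congr rfl fun i _ => ?_
        by_cases hi : β i = c i <;> simp [b, hi]
      rw [mono_of_le hab, mul_one, hγ]
      exact hk
    intro x hx
    obtain ⟨d, f, hd, rfl⟩ := exists_isPolar_of_mem_poleSub hx
    refine mono_mem_of_le (inf_le_left : d ⊓ b ≤ d) ?_ f
    refine hα.mono_mem_of_isPolar hc hS (fun i hi => (hK i hi).trans hKN.le) hb hbN
      ⟨fun i hi hiS => ?_, fun i hi => ?_⟩ inf_le_right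
    · simp [hd.eq_zero i hi hiS, hb.eq_zero i hi hiS]
    · exact inf_le_left.trans (hd.neg i hi)

end Simple

/-! ### Supports of the factors -/

section Support

variable {n m : ℕ} {α : Fin m → MvPolynomial (Fin n) ℂ} {β : Fin m → ℂ} {c : Fin m → ℤ}

lemma mem_weylSupport {M : Type*} [AddCommGroup M] [Module (WeylAlgebra n) M] {p : Fin n → ℂ} :
    p ∈ weylSupport (n := n) M ↔
      ∃ x : M, ∀ g : MvPolynomial (Fin n) ℂ, eval p g ≠ 0 → polyToWeyl n g • x ≠ 0 := by
  let _ : Module (MvPolynomial (Fin n) ℂ) M := Module.compHom M (polyToWeyl n).toRingHom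
  have h : ∀ g : MvPolynomial (Fin n) ℂ,
      g ∉ (pointToPoint p : PrimeSpectrum (MvPolynomial (Fin n) ℂ)).asIdeal ↔ eval p g ≠ 0 := by
    intro g
    rw [← coe_aeval_eq_eval]
    exact not_congr (mem_vanishingIdeal_singleton_iff (k := ℂ) p g)
  refine (Module.mem_support_iff' (R := MvPolynomial (Fin n) ℂ) (M := M)).trans ?_
  simp only [h]
  rfl

lemma weylSupport_congr {M M' : Type*} [AddCommGroup M] [Module (WeylAlgebra n) M]
    [AddCommGroup M'] [Module (WeylAlgebra n) M'] (e : M ≃ₗ[WeylAlgebra n] M') :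
    weylSupport (n := n) M = weylSupport (n := n) M' := by
  ext p
  rw [mem_weylSupport, mem_weylSupport]
  refine ⟨fun ⟨x, hx⟩ => ⟨e x, fun g hg h => hx g hg ?_⟩,
    fun ⟨x, hx⟩ => ⟨e.symm x, fun g hg h => hx g hg ?_⟩⟩
  · rwa [← map_smul, LinearEquiv.map_eq_zero_iff] at h
  · rwa [← map_smul, LinearEquiv.map_eq_zero_iff] at h

lemma mem_weylSupport_quotient {M : Type*} [AddCommGroup M] [Module (WeylAlgebra n) M]
    {K N : Submodule (WeylAlgebra n) M} {p : Fin n → ℂ} :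
    p ∈ weylSupport (n := n) (N ⧸ K.submoduleOf N) ↔
      ∃ x ∈ N, ∀ g : MvPolynomial (Fin n) ℂ, eval p g ≠ 0 → polyToWeyl n g • x ∉ K := by
  rw [mem_weylSupport, (Submodule.Quotient.mk_surjective (K.submoduleOf N)).exists]
  simp only [← Submodule.Quotient.mk_smul, ne_eq, Submodule.Quotient.mk_eq_zero, Subtype.exists]
  exact ⟨fun ⟨x, hx, h⟩ => ⟨x, hx, h⟩, fun ⟨x, hx, h⟩ => ⟨x, hx, h⟩⟩

/-- Off H_i, i ∈ S, a power of α_i moves any element into K. On the flat, a polynomial sending the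
element of residue 1 into K must vanish there. -/
lemma IsNormalCrossing.weylSupport_sup_poleSub (hα : IsNormalCrossing α)
    {S : Finset (Fin m)} (hS : ∀ i ∈ S, β i = c i)
    {K N : Submodule (WeylAlgebra n) (TwistedModule α β)} (hN : N = K ⊔ poleSub α β c S)
    (hK : ∀ i ∈ S, poleSub α β c (S.erase i) ≤ K)
    (hK' : K ≤ ⨆ i ∈ S, poleSub α β c (Finset.univ.erase i)) :
    weylSupport (n := n) (N ⧸ K.submoduleOf N) = flat α S := by
  classical
  subst hN
  ext p
  rw [mem_weylSupport_quotient]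
  refine ⟨fun ⟨x, hx, h⟩ i hi => ?_, fun hp => ?_⟩
  · by_contra hne
    obtain ⟨y, hy, z, hz, rfl⟩ := Submodule.mem_sup.1 hx
    obtain ⟨L, hL⟩ := exists_pow_smul_mem_poleSub hz i
    refine h (α i ^ L) (by rw [map_pow]; exact pow_ne_zero _ hne) ?_
    rw [smul_add]
    exact K.add_mem (K.smul_mem _ hy) (hK i hi hL)
  · let a : Fin m → ℤ := fun i => if i ∈ S then -1 else 0
    refine ⟨mono α β c a 1, Submodule.mem_sup_right
      (mono_mem_poleSub (fun i _ hi => by simp [a, hi]) 1), fun g hg h => hg ?_⟩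
    rw [poly_smul_mono, mul_one] at h
    exact hα.eval_eq_zero_of_mono_mem hS (fun i hi => by simp [a, hi]) (hK' h) hp

/-- Partial fractions: at every point some α_i, i ∈ S, is nonzero, so powers of the α_i generate the
unit ideal, and each power removes a pole. -/
lemma poleSub_le_iSup_of_flat_eq_empty {S : Finset (Fin m)} (hS : flat α S = ∅) :
    poleSub α β c S ≤ ⨆ i ∈ S, poleSub α β c (S.erase i) := by
  rintro _ ⟨a, f, ha, rfl⟩
  have hJ : coeffIdeal c (⨆ i ∈ S, poleSub α β c (S.erase i)) a = ⊤ := by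
    refine ideal_eq_top_of_forall_exists_eval_ne_zero _ fun p => ?_
    obtain ⟨i, hi, hpi⟩ : ∃ i ∈ S, eval p (α i) ≠ 0 := by
      by_contra! h
      exact (Set.eq_empty_iff_forall_notMem.1 hS p) h
    obtain ⟨L, hL⟩ := exists_pow_smul_mem_poleSub (mono_mem_poleSub ha (α := α) 1) i
    refine ⟨α i ^ L, ?_, by rw [map_pow]; exact pow_ne_zero _ hpi⟩
    rw [poly_smul_mono, mul_one] at hL
    exact Submodule.mem_iSup_of_mem i (Submodule.mem_iSup_of_mem hi hL)
  have : f ∈ coeffIdeal c (⨆ i ∈ S, poleSub α β c (S.erase i)) a := by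
    rw [hJ]; trivial
  exact this

lemma poleSub_le_of_forall_flat_nonempty (N : Submodule (WeylAlgebra n) (TwistedModule α β))
    (S : Finset (Fin m)) (h : ∀ S' ⊆ S, (flat α S').Nonempty → poleSub α β c S' ≤ N) :
    poleSub α β c S ≤ N := by
  induction S using Finset.strongInduction with
  | _ S ih =>
  rcases Set.eq_empty_or_nonempty (flat α S) with hS | hS
  · refine (poleSub_le_iSup_of_flat_eq_empty hS).trans (iSup₂_le fun i hi => ?_)
    exact ih _ (Finset.erase_ssubset hi) fun S' hS' => h S' (hS'.trans (Finset.erase_subset _ _))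
  · exact h S subset_rfl hS

/-! ### Assembly of the composition series -/

/-- A composition series of `M_α^β` with factors supported on prescribed distinct flats. -/
lemma IsNormalCrossing.exists_compositionSeries (hα : IsNormalCrossing α)
    (hc : ∀ i, β i ≠ c i → ∀ k : ℤ, β i ≠ k) :
    ∃ (s : CompositionSeries (Submodule (WeylAlgebra n) (TwistedModule α β)))
      (e : Fin s.length → Finset (Fin m)), s.head = ⊥ ∧ s.last = ⊤ ∧ Function.Injective e ∧
      (∀ S, (∃ j, e j = S) ↔ (∀ i ∈ S, β i = c i) ∧ (flat α S).Nonempty) ∧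
      ∀ j, weylSupport (n := n) (s j.succ ⧸ (s j.castSucc).submoduleOf (s j.succ))
        = flat α (e j) := by
  classical
  -- The colexicographic order is a linear order refining inclusion.
  let F : Finset (Colex (Finset (Fin m))) := (Finset.univ.filter fun S : Finset (Fin m) =>
    (∀ i ∈ S, β i = c i) ∧ (flat α S).Nonempty).image toColex
  let o := F.orderIsoOfFin rfl
  let e : Fin F.card → Finset (Fin m) := fun j => ofColex (o j : Colex (Finset (Fin m)))
  have he : ∀ S, (∃ j, e j = S) ↔ (∀ i ∈ S, β i = c i) ∧ (flat α S).Nonempty := by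
    intro S
    constructor
    · rintro ⟨j, rfl⟩
      obtain ⟨S, hS, h⟩ := Finset.mem_image.1 (o j).2
      have : e j = S := by simp [e, ← h]
      rw [this]
      exact (Finset.mem_filter.1 hS).2
    · intro h
      refine ⟨o.symm ⟨toColex S, Finset.mem_image_of_mem _
        (Finset.mem_filter.2 ⟨Finset.mem_univ _, h⟩)⟩, ?_⟩
      simp [e]
  have hmono : ∀ i j, e i ⊆ e j → i ≤ j := fun i j h =>
    o.le_iff_le.1 (Finset.Colex.toColex_le_toColex_of_subset h)
  have hinj : Function.Injective e := fun i j h =>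
    le_antisymm (hmono i j h.subset) (hmono j i h.symm.subset)
  let N : ℕ → Submodule (WeylAlgebra n) (TwistedModule α β) := fun j =>
    ⨆ (i : Fin F.card) (_ : i.val < j), poleSub α β c (e i)
  have hle : ∀ (i : Fin F.card) (j : ℕ), i.val < j → poleSub α β c (e i) ≤ N j := fun i j h =>
    le_iSup₂_of_le i h le_rfl
  have hsucc : ∀ j : Fin F.card, N (j + 1) = N j ⊔ poleSub α β c (e j) := by
    intro j
    refine le_antisymm (iSup₂_le fun i hi => ?_)
      (sup_le (iSup₂_le fun i hi => hle i _ (by omega)) (hle j _ (by omega)))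
    rcases Nat.lt_succ_iff_lt_or_eq.1 hi with h | h
    · exact (hle i _ h).trans le_sup_left
    · rw [Fin.ext h]
      exact le_sup_right
  have hS : ∀ j, ∀ i ∈ e j, β i = c i := fun j => ((he _).1 ⟨j, rfl⟩).1
  have hne : ∀ j, (flat α (e j)).Nonempty := fun j => ((he _).1 ⟨j, rfl⟩).2
  have hK : ∀ j, ∀ i ∈ e j, poleSub α β c ((e j).erase i) ≤ N j := by
    intro j i hi
    obtain ⟨k, hk⟩ := (he ((e j).erase i)).2 ⟨fun l hl => hS j l (Finset.mem_of_mem_erase hl),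
      (hne j).mono (flat_anti (Finset.erase_subset _ _))⟩
    rw [← hk]
    refine hle k j (lt_of_le_of_ne (hmono k j (hk ▸ Finset.erase_subset _ _)) fun h => ?_)
    rw [Fin.ext h] at hk
    exact Finset.notMem_erase i (e j) (hk ▸ hi)
  have hK' : ∀ j : Fin F.card,
      N j ≤ ⨆ i ∈ e j, poleSub α β c (Finset.univ.erase i) := by
    intro j
    refine iSup₂_le fun k hk => ?_
    -- An earlier set does not contain a later one, so each earlier submodule lacks the pole along
    -- some H_i with i in the later set.
    obtain ⟨i, hi, hik⟩ := Finset.not_subset.1 fun h => not_le_of_gt hk (hmono j k h)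
    refine le_iSup₂_of_le i hi (poleSub_mono fun l hl => ?_)
    exact Finset.mem_erase.2 ⟨fun h => hik (h ▸ hl), Finset.mem_univ _⟩
  let s : CompositionSeries (Submodule (WeylAlgebra n) (TwistedModule α β)) :=
    { length := F.card
      toFun := fun j => N j
      step := fun j => by
        change N j ⋖ N (j + 1)
        rw [hsucc]
        exact hα.covBy_sup_poleSub hc (hS j) (hne j) (hK j) (hK' j) }
  refine ⟨s, e, ?_, ?_, hinj, he, fun j => ?_⟩
  · change N 0 = ⊥
    simp [N]
  · change N F.card = ⊤
    -- The whole module is `poleSub` of all resonant indices, even when their common flat is empty.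
    rw [eq_top_iff, ← poleSub_eq_top (β := β) (c := c) (S := Finset.univ.filter fun i => β i = c i)
      (fun i hi => by simpa using hi)]
    refine poleSub_le_of_forall_flat_nonempty _ _ fun S' hS' hne' => ?_
    obtain ⟨j, rfl⟩ := (he S').2 ⟨fun i hi => (Finset.mem_filter.1 (hS' hi)).2, hne'⟩
    exact hle j _ j.2
  · exact hα.weylSupport_sup_poleSub (hS j) (hsucc j) (hK j) (hK' j)

/-- The number of factors with a given support does not depend on the composition series. -/
lemma numFactorsWithSupport_eq {M : Type*} [AddCommGroup M] [Module (WeylAlgebra n) M]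
    (s t : CompositionSeries (Submodule (WeylAlgebra n) M)) (hhead : s.head = t.head)
    (hlast : s.last = t.last) (Z : Set (Fin n → ℂ)) :
    numFactorsWithSupport s Z = numFactorsWithSupport t Z := by
  obtain ⟨f, hf⟩ := CompositionSeries.jordan_holder s t hhead hlast
  refine Nat.card_congr (f.subtypeEquiv fun j => ?_)
  have h : weylSupport (n := n) (s j.succ ⧸ (s j.castSucc).submoduleOf (s j.succ))
      = weylSupport (n := n) (t (f j).succ ⧸ (t (f j).castSucc).submoduleOf (t (f j).succ)) :=
    weylSupport_congr (hf j).linearEquiv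
  rw [h]

end Support

end WeylArrangement

end

/-! ### The main theorem -/

theorem mainTheorem1 {n m : ℕ} (α : Fin m → MvPolynomial (Fin n) ℂ)
    (hα : WeylArrangement.IsNormalCrossing α) (β : Fin m → ℂ)
    (S : Finset (Fin m)) (hS : (WeylArrangement.flat α S).Nonempty) :
    IsFiniteLength (WeylArrangement.WeylAlgebra n) (WeylArrangement.TwistedModule α β) ∧
    ∀ s : CompositionSeries
        (Submodule (WeylArrangement.WeylAlgebra n) (WeylArrangement.TwistedModule α β)),
      s.head = ⊥ → s.last = ⊤ →
        WeylArrangement.numFactorsWithSupport s (WeylArrangement.flat α S) ≤ 1 ∧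
        (WeylArrangement.numFactorsWithSupport s (WeylArrangement.flat α S) = 1 ↔
          ∀ i ∈ S, ∃ k : ℤ, β i = k) := by
  classical
  -- The default 0 is harmless: a nonintegral β_i differs from every integer.
  let c : Fin m → ℤ := fun i => if h : ∃ k : ℤ, β i = k then h.choose else 0
  have hcβ : ∀ i, (∃ k : ℤ, β i = k) ↔ β i = c i := fun i =>
    ⟨fun h => by simpa only [c, dif_pos h] using h.choose_spec, fun h => ⟨_, h⟩⟩
  obtain ⟨t, e, hhead, hlast, hinj, he, hsupp⟩ := hα.exists_compositionSeries (β := β) (c := c)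
    fun i hi k hk => hi ((hcβ i).1 ⟨k, hk⟩)
  refine ⟨isFiniteLength_iff_exists_compositionSeries.2 ⟨t, hhead, hlast⟩, fun s hs hs' => ?_⟩
  rw [WeylArrangement.numFactorsWithSupport_eq s t (hs.trans hhead.symm) (hs'.trans hlast.symm)]
  have hiff : ∀ j, WeylArrangement.weylSupport (n := n)
      (t j.succ ⧸ (t j.castSucc).submoduleOf (t j.succ)) = WeylArrangement.flat α S ↔ e j = S :=
    fun j => by
      rw [hsupp]
      exact ⟨fun h => (hα.flat_injOn hS h.symm).symm, fun h => by rw [h]⟩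
  have hsub : Subsingleton {j : Fin t.length // WeylArrangement.weylSupport (n := n)
      (t j.succ ⧸ (t j.castSucc).submoduleOf (t j.succ)) = WeylArrangement.flat α S} :=
    ⟨fun x y => Subtype.ext (hinj (((hiff _).1 x.2).trans ((hiff _).1 y.2).symm))⟩
  unfold WeylArrangement.numFactorsWithSupport
  refine ⟨Finite.card_le_one_iff_subsingleton.2 hsub, ?_⟩
  rw [Nat.card_eq_one_iff_unique, and_iff_right hsub, nonempty_subtype]
  simp_rw [hiff, he, and_iff_left hS, hcβ]
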